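/- Let $\Lambda\subset\mathbb{C}$ be a lattice and let $f$ be a non-constant elliptic function with respect to $\Lambda$ (meromorphic on $\mathbb{C}$ and $\Lambda$-periodic). Let $\mathbf a_1,\dots,\mathbf a_A$ and $\mathbf b_1,\dots,\mathbf b_B$ be representatives modulo $\Lambda$ of the distinct zeros and of the distinct poles of $f$, with multiplicities $n_1,\dots,n_A$ and $m_1,\dots,m_B$, and assume $K:=A+B>2$. For a $\Lambda$-elliptic function $g$, the desingularized Newton flow $\overline{\overline{\mathcal N}}(g)$ is the vector field on the torus $T=\mathbb{C}/\Lambda$ induced by $$\frac{dz}{dt}=-\bigl(1+|g(z)|^4\bigr)^{-1}\,\overline{g'(z)}\,g(z),$$ extended by $0$ to the poles of $g$. Its saddles are its equilibria that are neither zeros nor poles of $g$; a saddle is called $k$-fold if it is a $k$-fold zero of $g'$. Then for every $\varepsilon>0$ there are points $a_1,\dots,a_A$ and $b_1,\dots,b_B$ in $\mathbb{C}$ with $|a_i-\mathbf a_i|<\varepsilon$ and $|b_j-\mathbf b_j|<\varepsilon$ for all $i,j$, and with $$\sum_i n_ia_i-\sum_j m_jb_j=\sum_i n_i\mathbf a_i-\sum_j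 m_j\mathbf b_j ,$$ such that there exists a $\Lambda$-elliptic function $g$ whose distinct zeros and poles modulo $\Lambda$ are exactly $a_1,\dots,a_A$, with the multiplicities $n_1,\dots,n_A$, and $b_1,\dots,b_B$, with the multiplicities $m_1,\dots,m_B$, respectively; and, for every such $g$, the flow $\overline{\overline{\mathcal N}}(g)$ has precisely $K$ different saddles on $T$, and all of them are $1$-fold. (In particular, each is a hyperbolic saddle: the Jacobi matrix of the planar vector field above has negative determinant there.) Moreover, if $\Lambda$ is the full period lattice of $f$, then it is also the full period lattice of every such $g$. -/

import Mathlib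

namespace EllipticNewton

/-- `f` is a (non-constant) elliptic function for the lattice `Λ = L.lattice`: it is meromorphic
on `ℂ`, is periodic with respect to all points of `Λ`, and is not constant.  Meromorphic functions
are represented in normal form, i.e. all removable singularities are removed and the (irrelevant)
value of `f` at a pole is `0`. -/
structure IsElliptic (L : PeriodPair) (f : ℂ → ℂ) : Prop where
  meromorphic : MeromorphicNFOn f Set.univ
  periodic : ∀ l ∈ L.lattice, Function.Periodic f l
  nonconstant : ∀ c : ℂ, f ≠ fun _ => c

/-- `L.lattice` is the full period lattice of `f`: each period of `f` is of the form
`k ω₁ + l ω₂` with integers `k`, `l`. -/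
def HasBasicPeriods (L : PeriodPair) (f : ℂ → ℂ) : Prop :=
  ∀ p : ℂ, Function.Periodic f p → p ∈ L.lattice

/-- Modulo the lattice, the distinct zeros of `f` are `a 0, …, a (A - 1)`, with multiplicities
`n i`, and the distinct poles of `f` are `b 0, …, b (B - 1)`, with multiplicities `m j`. -/
structure HasZerosPoles (L : PeriodPair) {A B : ℕ} (f : ℂ → ℂ)
    (a : Fin A → ℂ) (n : Fin A → ℕ) (b : Fin B → ℂ) (m : Fin B → ℕ) : Prop where
  n_pos : ∀ i, 0 < n i
  m_pos : ∀ j, 0 < m j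
  zeros_distinct : ∀ i i', a i - a i' ∈ L.lattice → i = i'
  poles_distinct : ∀ j j', b j - b j' ∈ L.lattice → j = j'
  order_zero : ∀ i, meromorphicOrderAt f (a i) = ((n i : ℤ) : WithTop ℤ)
  order_pole : ∀ j, meromorphicOrderAt f (b j) = ((-(m j : ℤ) : ℤ) : WithTop ℤ)
  zero_mem : ∀ z, 0 < meromorphicOrderAt f z → ∃ i, z - a i ∈ L.lattice
  pole_mem : ∀ z, meromorphicOrderAt f z < 0 → ∃ j, z - b j ∈ L.lattice

/-- The desingularized planar Newton flow, `dz/dt = -(1 + |f|⁴)⁻¹ conj(f') f`.  For `f` in normal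
form, the right hand side is `0` at the poles of `f`, which is the value of its continuous
extension. -/
noncomputable def newtonField (f : ℂ → ℂ) (z : ℂ) : ℂ :=
  -((1 + ‖f z‖ ^ 4 : ℝ) : ℂ)⁻¹ * (starRingEnd ℂ) (deriv f z) * f z

theorem newtonField_periodic {f : ℂ → ℂ} {l : ℂ} (h : Function.Periodic f l) :
    Function.Periodic (newtonField f) l := by
  intro z
  have hd : deriv f (z + l) = deriv f z := by
    rw [← deriv_comp_add_const]
    congr 1
    exact funext h
  simp only [newtonField, h z, hd]

/-- The elliptic Newton flow, as a vector field on the torus `ℂ / Λ` (all of whose tangent spaces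
are identified with `ℂ`). -/
noncomputable def torusNewtonField {L : PeriodPair} {f : ℂ → ℂ} (hf : IsElliptic L f) :
    ℂ ⧸ L.lattice → ℂ :=
  Quotient.lift (newtonField f) (by
    intro z w h
    have hl : z - w ∈ L.lattice := (Submodule.quotientRel_def L.lattice).1 h
    have := newtonField_periodic (hf.periodic _ hl) w
    rwa [add_sub_cancel] at this)

theorem torusNewtonField_mk {L : PeriodPair} {f : ℂ → ℂ} (hf : IsElliptic L f) (z : ℂ) :
    torusNewtonField hf (Submodule.Quotient.mk z) = newtonField f z := rfl

/-- The saddles of the elliptic Newton flow on the torus: the equilibria of the flow which are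
neither zeros nor poles of `f`. -/
def saddles {L : PeriodPair} {f : ℂ → ℂ} (hf : IsElliptic L f) : Set (ℂ ⧸ L.lattice) :=
  {x | torusNewtonField hf x = 0 ∧
    ∀ z : ℂ, Submodule.Quotient.mk z = x → meromorphicOrderAt f z = 0}

/-- `z` is a `k`-fold critical point of `f`, i.e. a `k`-fold zero of `f'` which is not a zero
of `f`; the Newton flow then has a `k`-fold saddle at `z`. -/
structure IsFoldSaddle (f : ℂ → ℂ) (k : ℕ) (z : ℂ) : Prop where
  equilibrium : newtonField f z = 0
  analyticAt : AnalyticAt ℂ f z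
  ne_zero : f z ≠ 0
  order : analyticOrderAt (deriv f) z = k

/-- `z` is a hyperbolic saddle of the planar vector field `X`: an equilibrium at which the real
Jacobi matrix of `X` has one positive and one negative eigenvalue, i.e. negative determinant. -/
def IsHyperbolicSaddle (X : ℂ → ℂ) (z : ℂ) : Prop :=
  X z = 0 ∧ ∃ D : ℂ →L[ℝ] ℂ, HasFDerivAt X D z ∧ D.det < 0

end EllipticNewton

namespace EllipticNewton

/-! Off the zeros and poles of `g`, the saddles of the flow are the zeros of `g'/g`. This function
has simple poles exactly at the `K` zeros and poles of `g`, and its orders on the torus add up to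
zero, so counted with multiplicity there are `K` saddles. Everything therefore reduces to making the
zeros of `g'/g` simple by moving the divisor; a simple zero is a 1-fold saddle, and the Jacobi
determinant there is negative.

Write `ζ = θ'/θ` for a theta function `θ` of the lattice. If `f` has divisor `∑ w k • [p k]`, then
`f = q * ∏ θ (z - p k) ^ w k` with `q` entire, zero-free and of constant logarithmic derivative `c`,
so `f'/f = ∑ w k * ζ (z - p k) + c`. The multipliers of `q` depend only on `∑ w k * p k`. Along a
perturbation `p k + s * v k` with `∑ w k * v k = 0` the same `q` and the same `c` serve, which is
the role of the constraint on the sums (`IsTheta.exists_elliptic_factor`,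
`IsTwist.logDeriv_eq_sum`).

The `s`-derivative of the perturbed `g'/g` at `s = 0` is `-∑ w k * v k * ζ' (z - p k)`. As a
functional on `{v | ∑ w k * v k = 0}` it vanishes only if `ζ'` takes one value at all the points `z
- p k`. But `ζ'` is elliptic with a single double pole, so it takes no value at three points of the
torus; this is where `K > 2` enters. Hence some `v` is transversal at the finitely many zeros of
`f'/f` at once (`IsTheta.exists_transversal`). By the implicit function theorem every multiple zero
then splits into simple ones for small `s ≠ 0` (`eventually_eq_zero_of_multiple_zero`), uniformly on
the torus by compactness (`IsTheta.eventually_simple_zeros`).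

Finally, a period of `g` permutes the points of its divisor, so modulo the lattice only finitely
many translations are candidates, and not being a period is stable under small perturbations
(`IsTwist.eventually_not_periodic`). -/

open Filter Topology Complex
open scoped Real

/-! ### Infinite products and the theta function of a lattice. -/

/-- The entire function `u ↦ ∏ (1 - qⁿ u)`, for `‖q‖ < 1`. -/
noncomputable def qProd (q u : ℂ) : ℂ := ∏' n : ℕ, (1 + -(q ^ n * u))

theorem summable_norm_qProd {q : ℂ} (hq : ‖q‖ < 1) (u : ℂ) :
    Summable fun n : ℕ => ‖-(q ^ n * u)‖ := by
  simpa using (summable_geometric_of_lt_one (norm_nonneg _) hq).mul_right ‖u‖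

theorem qProd_eq {q : ℂ} (hq : ‖q‖ < 1) (u : ℂ) :
    qProd q u = (1 - u) * qProd q (q * u) := by
  set f : ℕ → ℂ := fun n => 1 + -(q ^ n * u) with hf
  have e : (fun n : ℕ => f (n + 1)) = fun n : ℕ => 1 + -(q ^ n * (q * u)) :=
    funext fun n => by simp only [hf, pow_succ, mul_assoc]
  have h' : Multipliable fun n : ℕ => f (n + 1) :=
    e ▸ multipliable_one_add_of_summable (summable_norm_qProd hq (q * u))
  have h₀ : f 0 = 1 - u := by simp [hf, sub_eq_add_neg]
  have h₂ : ∏' n, f (n + 1) = qProd q (q * u) := congrArg tprod e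
  have h₁ : ∏' n, f n = f 0 * ∏' n, f (n + 1) := tprod_eq_zero_mul' h'
  rw [← h₀, ← h₂, ← h₁, qProd]

theorem qProd_eq_zero_iff {q : ℂ} (hq : ‖q‖ < 1) (u : ℂ) :
    qProd q u = 0 ↔ ∃ n : ℕ, q ^ n * u = 1 := by
  constructor
  · intro h
    by_contra! hne
    refine tprod_one_add_ne_zero_of_summable (fun n hn => hne n ?_) (summable_norm_qProd hq u) h
    linear_combination -hn
  · rintro ⟨n, hn⟩
    induction n generalizing u with
    | zero =>
      rw [qProd_eq hq]
      simp_all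
    | succ k ih =>
      rw [qProd_eq hq, ih (q * u) (by rw [← hn]; ring), mul_zero]

theorem differentiable_qProd {q : ℂ} (hq : ‖q‖ < 1) : Differentiable ℂ (qProd q) := by
  intro u
  have key : DifferentiableOn ℂ (qProd q) (Metric.ball 0 (‖u‖ + 1)) := by
    have hu : Summable fun n : ℕ => ‖q‖ ^ n * (‖u‖ + 1) :=
      (summable_geometric_of_lt_one (norm_nonneg _) hq).mul_right _
    have := Summable.hasProdLocallyUniformlyOn_nat_one_add (f := fun n u => -(q ^ n * u))
      (K := Metric.ball (0 : ℂ) (‖u‖ + 1)) Metric.isOpen_ball hu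
      (.of_forall fun n x hx => by
        rw [norm_neg, norm_mul, norm_pow]
        gcongr
        exact (mem_ball_zero_iff.1 hx).le)
      (fun n => by fun_prop)
    exact this.differentiableOn
      (.of_forall fun _ => by simpa [Finset.prod_fn] using
        DifferentiableOn.finsetProd (fun _ _ => by fun_prop)) Metric.isOpen_ball
  exact (key u (by simp)).differentiableAt (Metric.isOpen_ball.mem_nhds (by simp))

/-- A theta function for the lattice `L.lattice`, with respect to a basis `ω₁`, `ω₂` of it: an
entire function with simple zeros at the lattice points, periodic with respect to `ω₁` and
quasi-periodic with respect to `ω₂`. -/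
structure IsTheta (L : PeriodPair) (ω₁ ω₂ κ μ : ℂ) (θ : ℂ → ℂ) : Prop where
  mem_iff : ∀ l, l ∈ L.lattice ↔ ∃ m n : ℤ, m * ω₁ + n * ω₂ = l
  diff : Differentiable ℂ θ
  zero_iff : ∀ z, θ z = 0 ↔ z ∈ L.lattice
  deriv_ne : ∀ l ∈ L.lattice, deriv θ l ≠ 0
  add₁ : ∀ z, θ (z + ω₁) = θ z
  add₂ : ∀ z, θ (z + ω₂) = cexp (κ * z + μ) * θ z
  ω₁_ne : ω₁ ≠ 0
  κ_ne : κ ≠ 0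

theorem invariant_of_basis {ω₁ ω₂ : ℂ} {P : ℂ → Prop} (h₁ : ∀ z, P (z + ω₁) ↔ P z)
    (h₂ : ∀ z, P (z + ω₂) ↔ P z) (m n : ℤ) (z : ℂ) : P (z + (m * ω₁ + n * ω₂)) ↔ P z := by
  have key : ∀ ω : ℂ, (∀ z, P (z + ω) ↔ P z) → ∀ (k : ℤ) z, P (z + k * ω) ↔ P z := by
    intro ω h k
    induction k with
    | zero => simp
    | succ k ih =>
      intro z
      rw [← ih z, ← h (z + (k : ℤ) * ω)]
      push_cast
      ring_nf
    | pred k ih =>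
      intro z
      rw [← ih z, ← h (z + ((-k - 1 : ℤ) : ℂ) * ω)]
      push_cast
      ring_nf
  rw [← add_assoc, key _ h₂, key _ h₁]

theorem norm_exp_tau_lt_one {τ : ℂ} (hτ : 0 < τ.im) : ‖cexp (2 * π * I * τ)‖ < 1 := by
  rw [Complex.norm_exp, Real.exp_lt_one_iff]
  simpa using by positivity

/-- The theta function of the lattice spanned by `1` and `τ`. -/
noncomputable def theta (τ z : ℂ) : ℂ :=
  qProd (cexp (2 * π * I * τ)) (cexp (2 * π * I * z)) *
    qProd (cexp (2 * π * I * τ)) (cexp (2 * π * I * (τ - z)))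

theorem differentiable_theta {τ : ℂ} (hτ : 0 < τ.im) : Differentiable ℂ (theta τ) := by
  have h := differentiable_qProd (norm_exp_tau_lt_one hτ)
  exact (h.comp (g := qProd _) (f := fun z => cexp (2 * π * I * z)) (by fun_prop)).mul
    (h.comp (g := qProd _) (f := fun z => cexp (2 * π * I * (τ - z))) (by fun_prop))

theorem theta_add_one (τ z : ℂ) : theta τ (z + 1) = theta τ z := by
  unfold theta
  congr 2
  · rw [mul_add, Complex.exp_add, mul_one, Complex.exp_two_pi_mul_I, mul_one]
  · rw [show 2 * π * I * (τ - (z + 1)) = 2 * π * I * (τ - z) - 2 * π * I by ring,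
      Complex.exp_sub, Complex.exp_two_pi_mul_I, div_one]

/-- With `u = exp (2πiz)`, the shift by `τ` removes the factor `1 - u` from the first product and
adds `1 - 1/u` to the second; the quotient of the two is `-1/u`. -/
theorem theta_add_tau {τ : ℂ} (hτ : 0 < τ.im) (z : ℂ) :
    theta τ (z + τ) = cexp (-(2 * π * I) * z + π * I) * theta τ z := by
  unfold theta
  have hq := norm_exp_tau_lt_one hτ
  rw [qProd_eq hq (cexp (2 * π * I * z)), qProd_eq hq (cexp (2 * π * I * (τ - (z + τ)))),
    ← Complex.exp_add, ← Complex.exp_add, Complex.exp_add _ (π * I), Complex.exp_pi_mul_I]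
  rw [show 2 * π * I * τ + 2 * π * I * (τ - (z + τ)) = 2 * π * I * (τ - z) by ring,
    show 2 * π * I * (z + τ) = 2 * π * I * τ + 2 * π * I * z by ring,
    show 2 * π * I * (τ - (z + τ)) = -(2 * π * I) * z by ring]
  have : cexp (-(2 * π * I) * z) * cexp (2 * π * I * z) = 1 := by
    rw [← Complex.exp_add]
    simp
  linear_combination (-qProd (cexp (2 * π * I * τ)) (cexp (2 * π * I * τ + 2 * π * I * z)) *
    qProd (cexp (2 * π * I * τ)) (cexp (2 * π * I * (τ - z)))) * this

theorem theta_eq_zero_iff {τ : ℂ} (hτ : 0 < τ.im) (z : ℂ) :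
    theta τ z = 0 ↔ ∃ m n : ℤ, (m : ℂ) + n * τ = z := by
  have hq := norm_exp_tau_lt_one hτ
  have hpi : (2 * π * I : ℂ) ≠ 0 := Complex.two_pi_I_ne_zero
  unfold theta
  rw [mul_eq_zero, qProd_eq_zero_iff hq, qProd_eq_zero_iff hq]
  simp only [← Complex.exp_nat_mul, ← Complex.exp_add, Complex.exp_eq_one_iff]
  constructor
  · rintro (⟨n, k, h⟩ | ⟨n, k, h⟩)
    · refine ⟨k, -n, mul_left_cancel₀ hpi ?_⟩
      push_cast
      linear_combination -h
    · refine ⟨-k, n + 1, mul_left_cancel₀ hpi ?_⟩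
      push_cast
      linear_combination h
  · rintro ⟨m, n, rfl⟩
    rcases le_or_gt n 0 with hn | hn
    · obtain ⟨k, rfl⟩ := Int.exists_eq_neg_ofNat hn
      refine Or.inl ⟨k, m, ?_⟩
      push_cast
      ring
    · obtain ⟨k, hk⟩ := Int.eq_ofNat_of_zero_le (a := n - 1) (by omega)
      obtain rfl : n = k + 1 := by omega
      refine Or.inr ⟨k, -m, ?_⟩
      push_cast
      ring

/-- The factor `1 - exp (2πiz)` carries the zero at `0` and is simple there; the remaining factor
`r` is nonzero at `0` because no positive power of the nome `q` equals `1`. -/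
theorem deriv_theta_zero_ne {τ : ℂ} (hτ : 0 < τ.im) : deriv (theta τ) 0 ≠ 0 := by
  have hq := norm_exp_tau_lt_one hτ
  set q := cexp (2 * π * I * τ)
  set r : ℂ → ℂ := fun z => qProd q (q * cexp (2 * π * I * z)) *
    qProd q (cexp (2 * π * I * (τ - z))) with hr
  have h : theta τ = fun z => (1 - cexp (2 * π * I * z)) * r z := by
    funext z
    rw [theta, qProd_eq hq (cexp (2 * π * I * z)), mul_assoc]
  have hrd : Differentiable ℂ r :=
    ((differentiable_qProd hq).comp (f := fun z => q * cexp (2 * π * I * z)) (by fun_prop)).mul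
      ((differentiable_qProd hq).comp (f := fun z => cexp (2 * π * I * (τ - z))) (by fun_prop))
  have hr0 : r 0 ≠ 0 := by
    have hne : qProd q q ≠ 0 := by
      rw [Ne, qProd_eq_zero_iff hq]
      rintro ⟨n, hn⟩
      have : ‖q‖ ^ (n + 1) = 1 := by rw [← norm_pow, pow_succ, hn, norm_one]
      exact (pow_lt_one₀ (norm_nonneg _) hq (Nat.succ_ne_zero n)).ne this
    simpa [hr, q] using hne
  have hd : HasDerivAt (fun z => 1 - cexp (2 * π * I * z)) (-(2 * π * I)) 0 := by
    have : HasDerivAt (fun z => 1 - cexp (2 * π * I * z))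
        (-(cexp (2 * π * I * 0) * (2 * π * I * 1))) 0 :=
      (((hasDerivAt_id (0 : ℂ)).const_mul (2 * π * I)).cexp).const_sub 1
    simpa using this
  rw [h, (hd.fun_mul (hrd 0).hasDerivAt).deriv]
  simp [hr0, Real.pi_ne_zero]

theorem exists_isTheta_of_im_pos (L : PeriodPair) {ω₁ ω₂ : ℂ} (h₁ : ω₁ ≠ 0)
    (hspan : ∀ l, l ∈ L.lattice ↔ ∃ m n : ℤ, m * ω₁ + n * ω₂ = l) (him : 0 < (ω₂ / ω₁).im) :
    ∃ κ μ θ, IsTheta L ω₁ ω₂ κ μ θ := by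
  set τ := ω₂ / ω₁ with hτ
  set θ : ℂ → ℂ := fun z => theta τ (z / ω₁) with hθ
  have hdiff : Differentiable ℂ θ := (differentiable_theta him).comp (by fun_prop)
  have hzero : ∀ z, θ z = 0 ↔ z ∈ L.lattice := by
    intro z
    rw [hθ, theta_eq_zero_iff him, hspan]
    refine exists_congr fun m => exists_congr fun n => ?_
    rw [hτ]
    field_simp
  have hadd₁ : ∀ z, θ (z + ω₁) = θ z := by
    intro z
    simp only [hθ]
    rw [add_div, div_self h₁, theta_add_one]
  have hadd₂ : ∀ z, θ (z + ω₂) = cexp (-(2 * π * I) / ω₁ * z + π * I) * θ z := by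
    intro z
    simp only [hθ]
    rw [add_div, ← hτ, theta_add_tau him]
    congr 2
    ring
  refine ⟨-(2 * π * I) / ω₁, π * I, θ, hspan, hdiff, hzero, ?_, hadd₁, hadd₂, h₁,
    div_ne_zero (neg_ne_zero.2 Complex.two_pi_I_ne_zero) h₁⟩
  have hd₁ : ∀ z, deriv θ (z + ω₁) = deriv θ z := by
    intro z
    rw [← deriv_comp_add_const]
    congr 1
    exact funext hadd₁
  have hd₂ : ∀ z, θ z = 0 → (deriv θ (z + ω₂) ≠ 0 ↔ deriv θ z ≠ 0) := by
    intro z hz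
    rw [← deriv_comp_add_const, funext hadd₂,
      deriv_fun_mul (by fun_prop) (hdiff z), hz]
    simp [Complex.exp_ne_zero]
  intro l hl
  obtain ⟨m, n, rfl⟩ := (hspan l).1 hl
  -- The value of `deriv θ` is not periodic, but having a simple zero is an invariant property:
  -- where `θ` vanishes, the derivative of the multiplier drops out of the product rule.
  have := (invariant_of_basis (ω₁ := ω₁) (ω₂ := ω₂) (P := fun z => θ z = 0 ∧ deriv θ z ≠ 0)
    (fun z => by rw [hadd₁, hd₁]) (fun z => by
      rw [hadd₂, mul_eq_zero, or_iff_right (Complex.exp_ne_zero _)]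
      exact and_congr_right (hd₂ z)) m n 0).2
    ⟨(hzero 0).2 (zero_mem _), by
      have h0 : HasDerivAt θ (deriv (theta τ) (0 / ω₁) * (1 / ω₁)) 0 :=
        ((differentiable_theta him _).hasDerivAt).comp (0 : ℂ) ((hasDerivAt_id (0 : ℂ)).div_const ω₁)
      rw [h0.deriv, zero_div]
      exact mul_ne_zero (deriv_theta_zero_ne him) (one_div_ne_zero h₁)⟩
  rw [zero_add] at this
  exact this.2

theorem exists_isTheta (L : PeriodPair) : ∃ ω₁ ω₂ κ μ θ, IsTheta L ω₁ ω₂ κ μ θ := by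
  have h₁ : L.ω₁ ≠ 0 := L.indep.ne_zero 0
  have him : (L.ω₂ / L.ω₁).im ≠ 0 := by
    intro h
    have := LinearIndependent.pair_iff.mp L.indep (L.ω₂ / L.ω₁).re (-1) (by
      have e : (((L.ω₂ / L.ω₁).re : ℝ) : ℂ) = L.ω₂ / L.ω₁ := by
        apply Complex.ext <;> simp [h]
      rw [Complex.real_smul, e]
      field_simp
      simp)
    norm_num at this
  rcases lt_or_gt_of_ne him with h | h
  -- Replacing `ω₂` by `-ω₂` keeps the lattice and makes the imaginary part positive.
  · obtain ⟨κ, μ, θ, hθ⟩ := exists_isTheta_of_im_pos L (ω₁ := L.ω₁) (ω₂ := -L.ω₂) h₁ (by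
      intro l
      rw [PeriodPair.mem_lattice]
      refine exists_congr fun m => ⟨?_, ?_⟩ <;>
      · rintro ⟨n, hn⟩
        exact ⟨-n, by rw [← hn]; push_cast; ring⟩) (by
      rw [neg_div, Complex.neg_im]
      linarith)
    exact ⟨_, _, κ, μ, θ, hθ⟩
  · obtain ⟨κ, μ, θ, hθ⟩ := exists_isTheta_of_im_pos L h₁ (fun l => PeriodPair.mem_lattice) h
    exact ⟨_, _, κ, μ, θ, hθ⟩

/-! ### Divisors and theta quotients. -/

open Classical in
/-- Modulo the lattice, the divisor of `f` is `∑ k, w k • [p k]`. -/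
def HasDivisor (L : PeriodPair) {ι : Type*} [Fintype ι] (f : ℂ → ℂ) (p : ι → ℂ) (w : ι → ℤ) :
    Prop :=
  ∀ z, meromorphicOrderAt f z = ((∑ k, if z - p k ∈ L.lattice then w k else 0 : ℤ) : WithTop ℤ)

theorem exists_compact_reps (L : PeriodPair) :
    ∃ K : Set ℂ, IsCompact K ∧ ∀ z, ∃ l ∈ L.lattice, z - l ∈ K := by
  refine ⟨closure (ZSpan.fundamentalDomain L.basis),
    (ZSpan.fundamentalDomain_isBounded L.basis).isCompact_closure, fun z =>
    ⟨ZSpan.floor L.basis z, ?_, ?_⟩⟩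
  · rw [L.lattice_eq_span_range_basis]
    exact (ZSpan.floor L.basis z).2
  · exact subset_closure (ZSpan.fract_mem_fundamentalDomain L.basis z)

theorem eq_of_differentiable_of_periodic {L : PeriodPair} {f : ℂ → ℂ} (hf : Differentiable ℂ f)
    (hper : ∀ l ∈ L.lattice, Function.Periodic f l) (z w : ℂ) : f z = f w := by
  obtain ⟨K, hK, hred⟩ := exists_compact_reps L
  refine hf.apply_eq_apply_of_bounded ((hK.image hf.continuous).isBounded.subset ?_) z w
  rintro _ ⟨z, rfl⟩
  obtain ⟨l, hl, hz⟩ := hred z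
  exact ⟨z - l, hz, (hper l hl).sub_eq z⟩

theorem IsTheta.periodic {L : PeriodPair} {ω₁ ω₂ κ μ : ℂ} {θ : ℂ → ℂ}
    (hθ : IsTheta L ω₁ ω₂ κ μ θ) {f : ℂ → ℂ} (h₁ : Function.Periodic f ω₁)
    (h₂ : Function.Periodic f ω₂) (l : ℂ) (hl : l ∈ L.lattice) : Function.Periodic f l := by
  intro z
  obtain ⟨m, n, rfl⟩ := (hθ.mem_iff l).1 hl
  exact (invariant_of_basis (P := fun u => f u = f z) (fun u => by rw [h₁]) (fun u => by rw [h₂])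
    m n z).2 rfl

theorem IsTheta.ω₁_mem {L : PeriodPair} {ω₁ ω₂ κ μ : ℂ} {θ : ℂ → ℂ}
    (hθ : IsTheta L ω₁ ω₂ κ μ θ) : ω₁ ∈ L.lattice :=
  (hθ.mem_iff _).2 ⟨1, 0, by simp⟩

theorem IsTheta.ω₂_mem {L : PeriodPair} {ω₁ ω₂ κ μ : ℂ} {θ : ℂ → ℂ}
    (hθ : IsTheta L ω₁ ω₂ κ μ θ) : ω₂ ∈ L.lattice :=
  (hθ.mem_iff _).2 ⟨0, 1, by simp⟩

theorem IsTheta.order {L : PeriodPair} {ω₁ ω₂ κ μ : ℂ} {θ : ℂ → ℂ}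
    (hθ : IsTheta L ω₁ ω₂ κ μ θ) (z : ℂ) [Decidable (z ∈ L.lattice)] :
    meromorphicOrderAt θ z = ((if z ∈ L.lattice then 1 else 0 : ℤ) : WithTop ℤ) := by
  have ha : AnalyticAt ℂ θ z := hθ.diff.analyticAt z
  rw [ha.meromorphicOrderAt_eq]
  split_ifs with h
  · have := ha.analyticOrderAt_sub_eq_one_of_deriv_ne_zero (hθ.deriv_ne z h)
    rw [(hθ.zero_iff z).2 h] at this
    simp only [sub_zero] at this
    rw [this]
    rfl
  · rw [ha.analyticOrderAt_eq_zero.2 (mt (hθ.zero_iff z).1 h)]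
    rfl

/-- The product of the theta functions with divisor `∑ k, w k • [p k]`. -/
noncomputable def thetaProd {ι : Type*} [Fintype ι] (θ : ℂ → ℂ) (p : ι → ℂ) (w : ι → ℤ) (z : ℂ) :
    ℂ :=
  ∏ k, θ (z - p k) ^ w k

section

variable {L : PeriodPair} {ω₁ ω₂ κ μ : ℂ} {θ : ℂ → ℂ} {ι : Type*} [Fintype ι]

theorem IsTheta.meromorphic_sub (hθ : IsTheta L ω₁ ω₂ κ μ θ) (p : ℂ) :
    Meromorphic fun z => θ (z - p) := fun z =>
  ((hθ.diff.comp (differentiable_id.sub_const p)).analyticAt z).meromorphicAt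

theorem IsTheta.meromorphic_thetaProd (hθ : IsTheta L ω₁ ω₂ κ μ θ) (p : ι → ℂ) (w : ι → ℤ) :
    Meromorphic (thetaProd θ p w) := fun z =>
  MeromorphicAt.fun_prod fun k _ => (hθ.meromorphic_sub (p k) z).zpow (w k)

theorem IsTheta.hasDivisor_thetaProd (hθ : IsTheta L ω₁ ω₂ κ μ θ) (p : ι → ℂ) (w : ι → ℤ) :
    HasDivisor L (thetaProd θ p w) p w := by
  classical
  intro z
  unfold thetaProd
  rw [meromorphicOrderAt_fun_prod (f := fun k z => θ (z - p k) ^ w k)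
    fun k _ => (hθ.meromorphic_sub (p k) z).zpow (w k), WithTop.coe_sum]
  refine Finset.sum_congr rfl fun k _ => ?_
  refine (meromorphicOrderAt_zpow (hθ.meromorphic_sub (p k) z)).trans ?_
  rw [meromorphicOrderAt_fun_comp_sub_const_eq_meromorphicOrderAt, hθ.order]
  split_ifs
  · rw [← WithTop.coe_mul, mul_one]
  · rw [← WithTop.coe_mul, mul_zero]

theorem IsTheta.thetaProd_add₁ (hθ : IsTheta L ω₁ ω₂ κ μ θ) (p : ι → ℂ) (w : ι → ℤ) (z : ℂ) :
    thetaProd θ p w (z + ω₁) = thetaProd θ p w z := by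
  simp only [thetaProd, add_sub_right_comm, hθ.add₁]

theorem IsTheta.thetaProd_add₂ (hθ : IsTheta L ω₁ ω₂ κ μ θ) (p : ι → ℂ) (w : ι → ℤ) (z : ℂ) :
    thetaProd θ p w (z + ω₂) =
      cexp (κ * (∑ k, (w k : ℂ)) * z + (μ * (∑ k, (w k : ℂ)) - κ * ∑ k, (w k : ℂ) * p k)) *
        thetaProd θ p w z := by
  simp only [thetaProd, add_sub_right_comm, hθ.add₂, mul_zpow, Finset.prod_mul_distrib]
  congr 1
  simp only [← Complex.exp_int_mul, ← Complex.exp_sum]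
  congr 1
  simp only [Finset.mul_sum, Finset.sum_mul, ← Finset.sum_sub_distrib, ← Finset.sum_add_distrib]
  refine Finset.sum_congr rfl fun k _ => ?_
  ring

theorem IsTheta.analyticAt_thetaProd (hθ : IsTheta L ω₁ ω₂ κ μ θ) {p : ι → ℂ} (w : ι → ℤ) {z : ℂ}
    (hz : ∀ k, z - p k ∉ L.lattice) : AnalyticAt ℂ (thetaProd θ p w) z := by
  have : ∀ k, AnalyticAt ℂ (fun z => θ (z - p k) ^ w k) z := fun k =>
    ((hθ.diff.comp (differentiable_id.sub_const (p k))).analyticAt z).fun_zpow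
      (mt (hθ.zero_iff _).1 (hz k))
  exact Finset.univ.analyticAt_fun_prod fun k _ => this k

theorem IsTheta.thetaProd_ne_zero (hθ : IsTheta L ω₁ ω₂ κ μ θ) {p : ι → ℂ} (w : ι → ℤ) {z : ℂ}
    (hz : ∀ k, z - p k ∉ L.lattice) : thetaProd θ p w z ≠ 0 :=
  Finset.prod_ne_zero_iff.2 fun k _ => zpow_ne_zero _ (mt (hθ.zero_iff _).1 (hz k))

theorem IsTheta.logDeriv_thetaProd (hθ : IsTheta L ω₁ ω₂ κ μ θ) {p : ι → ℂ} (w : ι → ℤ) {z : ℂ}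
    (hz : ∀ k, z - p k ∉ L.lattice) :
    logDeriv (thetaProd θ p w) z = ∑ k, (w k : ℂ) * logDeriv θ (z - p k) := by
  have hne : ∀ k, θ (z - p k) ≠ 0 := fun k => mt (hθ.zero_iff _).1 (hz k)
  have hd : ∀ k, DifferentiableAt ℂ (fun z => θ (z - p k)) z := fun k =>
    (hθ.diff.comp (differentiable_id.sub_const (p k))) z
  have e : logDeriv (thetaProd θ p w) z = ∑ k, logDeriv (fun z => θ (z - p k) ^ w k) z :=
    logDeriv_prod (f := fun k z => θ (z - p k) ^ w k) (fun k _ => zpow_ne_zero _ (hne k))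
      (fun k _ => (hd k).zpow (Or.inl (hne k)))
  rw [e]
  refine Finset.sum_congr rfl fun k _ => ?_
  rw [logDeriv_fun_zpow (hd k)]
  congr 1
  rw [logDeriv_apply, logDeriv_apply, deriv_comp_sub_const]

theorem eq_of_nhdsNE {f g : ℂ → ℂ} {z : ℂ} (hf : ContinuousAt f z) (hg : ContinuousAt g z)
    (h : f =ᶠ[𝓝[≠] z] g) : f z = g z :=
  ((hf.eventuallyEq_nhds_iff_eventuallyEq_nhdsNE hg).1 h).eq_of_nhds

theorem tendsto_add_const_nhdsNE (z a : ℂ) : Tendsto (fun u => u + a) (𝓝[≠] z) (𝓝[≠] (z + a)) :=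
  tendsto_nhdsWithin_of_tendsto_nhds_of_eventually_within _
    ((continuous_add_const a).continuousAt.tendsto.mono_left nhdsWithin_le_nhds)
    (eventually_nhdsWithin_of_forall fun _ hu h => hu (add_right_cancel h))

/-- A meromorphic function with divisor `∑ k, w k • [p k]` is the product of the theta quotient
with that divisor and an entire function without zeros. -/
theorem IsTheta.exists_factor (hθ : IsTheta L ω₁ ω₂ κ μ θ) {f : ℂ → ℂ} (hf : Meromorphic f)
    {p : ι → ℂ} {w : ι → ℤ} (hdiv : HasDivisor L f p w) :
    ∃ q : ℂ → ℂ, Differentiable ℂ q ∧ (∀ z, q z ≠ 0) ∧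
      ∀ z, q =ᶠ[𝓝[≠] z] fun z => f z * (thetaProd θ p w z)⁻¹ := by
  have hΘ := hθ.meromorphic_thetaProd p w
  set Q : ℂ → ℂ := f * (thetaProd θ p w)⁻¹ with hQ
  have hQm : MeromorphicOn Q Set.univ := fun z _ => (hf z).mul (hΘ z).inv
  -- Both divisors agree, so the quotient has order `0` everywhere; its normal form is then entire
  -- without zeros.
  have hQo : ∀ z, meromorphicOrderAt Q z = 0 := by
    intro z
    rw [hQ, meromorphicOrderAt_mul (hf z) (hΘ z).inv, meromorphicOrderAt_inv, hdiv z,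
      hθ.hasDivisor_thetaProd p w z]
    norm_cast
    simp
  have hnf := meromorphicNFOn_toMeromorphicNFOn Q Set.univ
  have ho : ∀ z, meromorphicOrderAt (toMeromorphicNFOn Q Set.univ) z = 0 := fun z => by
    rw [meromorphicOrderAt_toMeromorphicNFOn hQm (Set.mem_univ z), hQo]
  exact ⟨toMeromorphicNFOn Q Set.univ, fun z =>
    ((hnf (Set.mem_univ z)).meromorphicOrderAt_nonneg_iff_analyticAt.1 (ho z).ge).differentiableAt,
    fun z => (hnf (Set.mem_univ z)).meromorphicOrderAt_eq_zero_iff.1 (ho z),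
    fun z => hQm.toMeromorphicNFOn_eq_self_on_nhdsNE (Set.mem_univ z)⟩

/-- The derivative of `q'/q` is entire and elliptic, hence constant, so `q'/q` is affine. Its period
`ω₁ ≠ 0` makes the slope `0`, and then its increment `κ * W` along `ω₂` vanishes. -/
theorem logDeriv_const_of_quasiPeriodic (hθ : IsTheta L ω₁ ω₂ κ μ θ) {q : ℂ → ℂ}
    (hq : Differentiable ℂ q) (hq0 : ∀ z, q z ≠ 0) {W ν : ℂ} (h₁ : ∀ z, q (z + ω₁) = q z)
    (h₂ : ∀ z, q (z + ω₂) = cexp (κ * W * z + ν) * q z) :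
    W = 0 ∧ ∃ c, ∀ z, logDeriv q z = c := by
  have hφd : Differentiable ℂ (logDeriv q) := fun z =>
    ((hq.analyticAt z).deriv.div (hq.analyticAt z) (hq0 z)).differentiableAt
  have hφ₁ : ∀ z, logDeriv q (z + ω₁) = logDeriv q z := by
    intro z
    rw [logDeriv_apply, logDeriv_apply, ← deriv_comp_add_const, h₁, funext h₁]
  have hφ₂ : ∀ z, logDeriv q (z + ω₂) = logDeriv q z + κ * W := by
    intro z
    rw [logDeriv_apply, ← deriv_comp_add_const, h₂, funext h₂,
      deriv_fun_mul (by fun_prop) (hq z), logDeriv_apply]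
    have : HasDerivAt (fun z => cexp (κ * W * z + ν))
        (cexp (κ * W * z + ν) * (κ * W * 1)) z :=
      (((hasDerivAt_id z).const_mul (κ * W)).add_const ν).cexp
    rw [this.deriv]
    have := hq0 z
    have := Complex.exp_ne_zero (κ * W * z + ν)
    field_simp
    ring
  have hdd : Differentiable ℂ (deriv (logDeriv q)) := fun z =>
    (hφd.analyticAt z).deriv.differentiableAt
  have hconst := eq_of_differentiable_of_periodic hdd (hθ.periodic (f := deriv (logDeriv q))
    (fun z => by rw [← deriv_comp_add_const, funext hφ₁])
    (fun z => by rw [← deriv_comp_add_const, funext hφ₂, deriv_add_const]))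
  set d := deriv (logDeriv q) 0
  have hlin : ∀ z, logDeriv q z = logDeriv q 0 + d * z := by
    intro z
    have hd0 : Differentiable ℂ fun z => logDeriv q z - d * z := by fun_prop
    have := is_const_of_deriv_eq_zero hd0 (fun z => by
      rw [deriv_fun_sub (hφd z) (by fun_prop), hconst z 0]
      simp [d]) z 0
    simp only [mul_zero, sub_zero] at this
    linear_combination this
  have hd : d = 0 := by
    have := hφ₁ 0
    rw [zero_add, hlin ω₁] at this
    exact (mul_eq_zero.1 (by linear_combination this)).resolve_right hθ.ω₁_ne
  refine ⟨?_, logDeriv q 0, fun z => by rw [hlin z, hd]; ring⟩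
  have := hφ₂ 0
  rw [zero_add, hlin ω₂, hd] at this
  exact (mul_eq_zero.1 (by linear_combination -this)).resolve_left hθ.κ_ne

/-- An entire function without zeros, with constant logarithmic derivative `c`, periodic with
respect to `ω₁` and with multiplier `exp (κ * ρ)` with respect to `ω₂`. -/
structure IsTwist (ω₁ ω₂ κ : ℂ) (q : ℂ → ℂ) (c ρ : ℂ) : Prop where
  diff : Differentiable ℂ q
  ne_zero : ∀ z, q z ≠ 0
  logDeriv_eq : ∀ z, logDeriv q z = c
  add₁ : ∀ z, q (z + ω₁) = q z
  add₂ : ∀ z, q (z + ω₂) = cexp (κ * ρ) * q z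

/-- An elliptic function is, up to a factor which is an entire function without zeros and with
constant logarithmic derivative, a theta quotient. Its orders add up to zero. -/
theorem IsTheta.exists_elliptic_factor (hθ : IsTheta L ω₁ ω₂ κ μ θ) {f : ℂ → ℂ}
    (hf : Meromorphic f) (hper : ∀ l ∈ L.lattice, Function.Periodic f l)
    {p : ι → ℂ} {w : ι → ℤ} (hdiv : HasDivisor L f p w) :
    ∑ k, w k = 0 ∧ ∃ (q : ℂ → ℂ) (c : ℂ), IsTwist ω₁ ω₂ κ q c (∑ k, (w k : ℂ) * p k) ∧
      ∀ z, f =ᶠ[𝓝[≠] z] fun u => q u * thetaProd θ p w u := by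
  obtain ⟨q, hqd, hq0, hq⟩ := hθ.exists_factor hf hdiv
  have transfer : ∀ a : ℂ, ∀ e : ℂ → ℂ, Differentiable ℂ e →
      (∀ z, f (z + a) * (thetaProd θ p w (z + a))⁻¹ = e z * (f z * (thetaProd θ p w z)⁻¹)) →
      ∀ z, q (z + a) = e z * q z := by
    intro a e he h z
    refine eq_of_nhdsNE (f := fun z => q (z + a)) (g := fun z => e z * q z)
      (hqd.continuous.comp (continuous_add_const a)).continuousAt
      (he.continuous.mul hqd.continuous).continuousAt ?_
    filter_upwards [hq z, (tendsto_add_const_nhdsNE z a).eventually (hq (z + a))] with u h₁ h₂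
    rw [h₁, h₂, h]
  have h₁ : ∀ z, q (z + ω₁) = q z := fun z => by
    rw [transfer ω₁ (fun _ => 1) (by fun_prop) (fun z => by
      rw [hθ.thetaProd_add₁, hper _ hθ.ω₁_mem, one_mul]), one_mul]
  have h₂ : ∀ z, q (z + ω₂) = cexp (κ * (-∑ k, (w k : ℂ)) * z +
      -(μ * (∑ k, (w k : ℂ)) - κ * ∑ k, (w k : ℂ) * p k)) * q z :=
    transfer ω₂ _ (by fun_prop) (fun z => by
      rw [hθ.thetaProd_add₂, hper _ hθ.ω₂_mem, mul_inv, ← Complex.exp_neg]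
      ring_nf)
  -- Here `W = -∑ w k`, so the degree vanishes, and the multiplier along `ω₂` reduces to the
  -- constant `exp (κ * ∑ w k * p k)`.
  obtain ⟨hW, c, hc⟩ := logDeriv_const_of_quasiPeriodic hθ hqd hq0 h₁ h₂
  refine ⟨by exact_mod_cast neg_eq_zero.1 hW, q, c, ⟨hqd, hq0, hc, h₁, fun z => ?_⟩, fun z => ?_⟩
  · rw [h₂, hW, neg_eq_zero.1 hW]
    ring_nf
  · have hne : ∀ᶠ u in 𝓝[≠] z, thetaProd θ p w u ≠ 0 :=
      (meromorphicOrderAt_ne_top_iff_eventually_ne_zero (hθ.meromorphic_thetaProd p w z)).1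
        (by rw [hθ.hasDivisor_thetaProd p w z]; exact WithTop.coe_ne_top)
    filter_upwards [hq z, hne] with u h₁ h₂
    rw [h₁, inv_mul_cancel_right₀ h₂]

end

/-! ### Orders on the torus and their sum. -/

theorem mk_eq_mk_iff {L : PeriodPair} {z w : ℂ} :
    (Submodule.Quotient.mk z : ℂ ⧸ L.lattice) = Submodule.Quotient.mk w ↔ z - w ∈ L.lattice :=
  Submodule.Quotient.eq _

theorem order_add_period {L : PeriodPair} {f : ℂ → ℂ}
    (hper : ∀ l ∈ L.lattice, Function.Periodic f l) {z w : ℂ} (h : z - w ∈ L.lattice) :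
    meromorphicOrderAt f z = meromorphicOrderAt f w := by
  have := meromorphicOrderAt_comp_add_const_eq_meromorphicOrderAt (f := f) (c := z - w) (x := w)
  rw [show f ∘ (fun u => u + (z - w)) = f from funext (hper _ h), add_sub_cancel] at this
  exact this.symm

/-- The order, at a point of the torus, of a periodic meromorphic function. -/
noncomputable def torusOrder (L : PeriodPair) (f : ℂ → ℂ) (x : ℂ ⧸ L.lattice) : ℤ :=
  (meromorphicOrderAt f (Quotient.out x)).untop₀

section

variable {L : PeriodPair} {f : ℂ → ℂ}

theorem torusOrder_mk (hper : ∀ l ∈ L.lattice, Function.Periodic f l) (z : ℂ) :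
    torusOrder L f (Submodule.Quotient.mk z) = (meromorphicOrderAt f z).untop₀ := by
  rw [torusOrder, order_add_period hper (z := Quotient.out _) (w := z)]
  exact mk_eq_mk_iff.1 (Submodule.Quotient.mk_out _)

theorem finite_support_torusOrder (hf : Meromorphic f)
    (hper : ∀ l ∈ L.lattice, Function.Periodic f l) :
    (Function.support (torusOrder L f)).Finite := by
  obtain ⟨K, hK, hred⟩ := exists_compact_reps L
  have hfin := (MeromorphicOn.divisor f K).finiteSupport hK
  refine (hfin.image (Submodule.Quotient.mk (p := L.lattice))).subset ?_
  intro x hx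
  obtain ⟨z, rfl⟩ := Submodule.Quotient.mk_surjective _ x
  obtain ⟨l, hl, hz⟩ := hred z
  have e : (Submodule.Quotient.mk (z - l) : ℂ ⧸ L.lattice) = Submodule.Quotient.mk z :=
    mk_eq_mk_iff.2 (by simpa using neg_mem hl)
  refine ⟨z - l, ?_, e⟩
  rw [Function.mem_support, MeromorphicOn.divisor_apply (fun u _ => hf u) hz, ← torusOrder_mk hper,
    e]
  exact hx

/-- The orders of an elliptic function at the points of the torus add up to zero. -/
theorem finsum_torusOrder (hf : Meromorphic f) (hper : ∀ l ∈ L.lattice, Function.Periodic f l)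
    (hne : ∀ z, meromorphicOrderAt f z ≠ ⊤) : ∑ᶠ x, torusOrder L f x = 0 := by
  obtain ⟨ω₁, ω₂, κ, μ, θ, hθ⟩ := exists_isTheta L
  have hfin := finite_support_torusOrder hf hper
  have hdiv : HasDivisor L f (fun x : hfin.toFinset => Quotient.out (x : ℂ ⧸ L.lattice))
      (fun x => torusOrder L f x) := by
    classical
    intro z
    -- As the order is never `⊤`, passing to the integer `torusOrder` loses nothing.
    rw [← WithTop.coe_untop₀_of_ne_top (hne z), ← torusOrder_mk hper]
    congr 1
    have key : ∀ x : ℂ ⧸ L.lattice,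
        z - Quotient.out x ∈ L.lattice ↔ x = Submodule.Quotient.mk z := by
      intro x
      rw [← mk_eq_mk_iff, Submodule.Quotient.mk_out, eq_comm]
    simp only [key]
    rw [Finset.sum_coe_sort hfin.toFinset
      (fun x => if x = Submodule.Quotient.mk z then torusOrder L f x else 0),
      Finset.sum_ite_eq']
    split_ifs with h
    · rfl
    · simpa using h
  have := (hθ.exists_elliptic_factor hf hper hdiv).1
  rw [finsum_eq_sum_of_support_subset _ (s := hfin.toFinset) (by simp), ← this,
    Finset.sum_coe_sort hfin.toFinset (fun x => torusOrder L f x)]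

end

/-! ### The logarithmic derivative of theta and its derivative. -/

section

variable {L : PeriodPair} {ω₁ ω₂ κ μ : ℂ} {θ : ℂ → ℂ}

theorem IsTheta.analyticAt_logDeriv (hθ : IsTheta L ω₁ ω₂ κ μ θ) {z : ℂ} (hz : z ∉ L.lattice) :
    AnalyticAt ℂ (logDeriv θ) z :=
  (hθ.diff.analyticAt z).deriv.div (hθ.diff.analyticAt z) (mt (hθ.zero_iff z).1 hz)

theorem IsTheta.logDeriv_add₁ (hθ : IsTheta L ω₁ ω₂ κ μ θ) (z : ℂ) :
    logDeriv θ (z + ω₁) = logDeriv θ z := by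
  rw [logDeriv_apply, logDeriv_apply, ← deriv_comp_add_const, hθ.add₁, funext hθ.add₁]

theorem IsTheta.logDeriv_add₂ (hθ : IsTheta L ω₁ ω₂ κ μ θ) {z : ℂ} (hz : z ∉ L.lattice) :
    logDeriv θ (z + ω₂) = logDeriv θ z + κ := by
  have h0 : θ z ≠ 0 := mt (hθ.zero_iff z).1 hz
  have hd : HasDerivAt (fun z => cexp (κ * z + μ)) (cexp (κ * z + μ) * (κ * 1)) z :=
    (((hasDerivAt_id z).const_mul κ).add_const μ).cexp
  rw [logDeriv_apply, ← deriv_comp_add_const, hθ.add₂, funext hθ.add₂,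
    deriv_fun_mul (by fun_prop) (hθ.diff z), logDeriv_apply, hd.deriv]
  have := Complex.exp_ne_zero (κ * z + μ)
  field_simp
  ring

theorem IsTheta.periodic_deriv_logDeriv (hθ : IsTheta L ω₁ ω₂ κ μ θ) :
    ∀ l ∈ L.lattice, Function.Periodic (deriv (logDeriv θ)) l := by
  have key : ∀ a : ℂ, a ∈ L.lattice → ∀ c : ℂ,
      (∀ z, z ∉ L.lattice → logDeriv θ (z + a) = logDeriv θ z + c) →
      Function.Periodic (deriv (logDeriv θ)) a := by
    intro a ha c h z
    rw [← deriv_comp_add_const]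
    have e : (fun z => logDeriv θ (z + a)) =ᶠ[𝓝[≠] z] fun z => logDeriv θ z + c := by
      have hmem : (↑L.lattice \ {z})ᶜ ∈ 𝓝[≠] z :=
        nhdsWithin_le_nhds (L.compl_lattice_sdiff_singleton_mem_nhds z)
      filter_upwards [hmem, self_mem_nhdsWithin] with u hu hne
      exact h u fun hmem => hu ⟨hmem, hne⟩
    by_cases hz : z ∈ L.lattice
    -- At a lattice point both derivatives take the default value `0`: `logDeriv θ` has a pole
    -- there, so it is not differentiable whatever value it is assigned.
    · have nd : ∀ u ∈ L.lattice, ¬ DifferentiableAt ℂ (logDeriv θ) u := by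
        intro u hu hd
        classical
        have hm := (hθ.diff.analyticAt u).meromorphicAt
        have ho : meromorphicOrderAt θ u = 1 := by
          rw [hθ.order u, if_pos hu]
          rfl
        have hlog := meromorphicOrderAt_logDeriv_eq_neg_one hm (by rw [ho]; decide)
          (by rw [ho]; decide)
        have ht := hd.continuousAt.tendsto.mono_left (nhdsWithin_le_nhds (s := {u}ᶜ))
        exact (tendsto_nhds_iff_meromorphicOrderAt_nonneg hm.logDeriv).1 ⟨_, ht⟩ |>.not_gt
          (by rw [hlog]; decide)
      have nd' : ¬ DifferentiableAt ℂ (fun z => logDeriv θ (z + a)) z := by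
        rw [differentiableAt_comp_add_const]
        exact nd _ (add_mem hz ha)
      rw [deriv_zero_of_not_differentiableAt nd', deriv_zero_of_not_differentiableAt (nd z hz)]
    · have hza : z + a ∉ L.lattice := fun h => hz (by simpa using sub_mem h ha)
      have c₁ : ContinuousAt (fun z => logDeriv θ (z + a)) z :=
        (hθ.analyticAt_logDeriv hza).continuousAt.comp (f := fun z => z + a)
          (continuous_add_const a).continuousAt
      have c₂ : ContinuousAt (fun z => logDeriv θ z + c) z :=
        (hθ.analyticAt_logDeriv hz).continuousAt.add continuousAt_const
      rw [((c₁.eventuallyEq_nhds_iff_eventuallyEq_nhdsNE c₂).1 e).deriv_eq, deriv_add_const]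
  exact hθ.periodic (key ω₁ hθ.ω₁_mem 0 fun z _ => by rw [hθ.logDeriv_add₁, add_zero]) (key ω₂ hθ.ω₂_mem κ fun z hz => hθ.logDeriv_add₂ hz)

/-- The derivative of the logarithmic derivative of `θ`, an elliptic function of order `2`, does
not take the same value at three points of the torus. -/
theorem IsTheta.exists_deriv_logDeriv_ne (hθ : IsTheta L ω₁ ω₂ κ μ θ) {ι : Type*} [Fintype ι]
    (hcard : 2 < Fintype.card ι) {t : ι → ℂ} (ht : ∀ k, t k ∉ L.lattice)
    (hinj : ∀ j k, t j - t k ∈ L.lattice → j = k) (C : ℂ) :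
    ∃ k, deriv (logDeriv θ) (t k) ≠ C := by
  classical
  by_contra! hC
  set g : ℂ → ℂ := deriv (logDeriv θ) + fun _ => -C with hg
  have hm : Meromorphic (deriv (logDeriv θ)) := fun z =>
    (hθ.diff.analyticAt z).meromorphicAt.logDeriv.deriv
  have hgm : Meromorphic g := fun z => (hm z).add (MeromorphicAt.const _ _)
  have hgper : ∀ l ∈ L.lattice, Function.Periodic g l := fun l hl z => by
    simp only [hg, Pi.add_apply, hθ.periodic_deriv_logDeriv l hl z]
  have ho : meromorphicOrderAt g 0 = (-2 : ℤ) := by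
    have h₁ : meromorphicOrderAt θ 0 = 1 := by
      rw [hθ.order 0, if_pos (zero_mem _)]
      rfl
    have h₂ : meromorphicOrderAt (logDeriv θ) 0 = (-1 : ℤ) :=
      meromorphicOrderAt_logDeriv_eq_neg_one ((hθ.diff.analyticAt 0).meromorphicAt)
        (by rw [h₁]; decide) (by rw [h₁]; decide)
    have h₃ := meromorphicOrderAt_deriv_eq_sub_one (by norm_num) h₂
    have h₄ : 0 ≤ meromorphicOrderAt (fun _ : ℂ => -C) 0 :=
      analyticAt_const.meromorphicOrderAt_nonneg
    rw [hg, meromorphicOrderAt_add_eq_left_of_lt (MeromorphicAt.const _ _), h₃]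
    · norm_num
    · rw [h₃]
      exact lt_of_lt_of_le (by decide) h₄
  have hne : ∀ z, meromorphicOrderAt g z ≠ ⊤ := fun z =>
    MeromorphicOn.meromorphicOrderAt_ne_top_of_isPreconnected (U := Set.univ) (x := 0)
      (fun u _ => hgm u) isPreconnected_univ (Set.mem_univ _) (Set.mem_univ _) (by rw [ho]; decide)
  have hga : ∀ z, z ∉ L.lattice → AnalyticAt ℂ g z := fun z hz =>
    (hθ.analyticAt_logDeriv hz).deriv.add analyticAt_const
  -- The contradiction: the orders of `g` add up to `0`, but they are `-2` at the origin, at least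
  -- `1` at more than two other points, and nowhere else negative.
  have hsum := finsum_torusOrder hgm hgper hne
  have hfin := finite_support_torusOrder hgm hgper
  set x₀ : ℂ ⧸ L.lattice := Submodule.Quotient.mk 0
  set T : Finset (ℂ ⧸ L.lattice) :=
    Finset.univ.image fun k => (Submodule.Quotient.mk (t k) : ℂ ⧸ L.lattice) with hT
  have hTcard : T.card = Fintype.card ι :=
    Finset.card_image_of_injective _ fun j k h => hinj j k (mk_eq_mk_iff.1 h)
  have hx₀T : x₀ ∉ T := by
    intro h
    obtain ⟨k, -, hk⟩ := Finset.mem_image.1 h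
    exact ht k (by simpa using mk_eq_mk_iff.1 hk)
  have h0 : torusOrder L g x₀ = -2 := by rw [torusOrder_mk hgper, ho]; rfl
  have hpos : ∀ x ∈ T, 1 ≤ torusOrder L g x := by
    intro x hx
    obtain ⟨k, -, rfl⟩ := Finset.mem_image.1 hx
    rw [torusOrder_mk hgper]
    have ha := hga _ (ht k)
    have h₁ : meromorphicOrderAt g (t k) ≠ 0 := by
      rw [Ne, ha.meromorphicNFAt.meromorphicOrderAt_eq_zero_iff]
      simp [hg, hC k]
    have h₂ := ha.meromorphicOrderAt_nonneg
    have h₃ := hne (t k)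
    lift meromorphicOrderAt g (t k) to ℤ using h₃ with n
    norm_cast at h₁ h₂
    simp only [WithTop.untop₀_coe]
    omega
  have hnonneg : ∀ x, x ≠ x₀ → 0 ≤ torusOrder L g x := by
    intro x hx
    obtain ⟨z, rfl⟩ := Submodule.Quotient.mk_surjective _ x
    have hz : z ∉ L.lattice := fun h => hx (mk_eq_mk_iff.2 (by simpa using h))
    rw [torusOrder_mk hgper]
    exact WithTop.untop₀_nonneg.2 (hga z hz).meromorphicOrderAt_nonneg
  set S : Finset (ℂ ⧸ L.lattice) := insert x₀ (hfin.toFinset ∪ T) with hS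
  rw [finsum_eq_sum_of_support_subset _ (s := S) (by
    intro x hx
    simp [hS, Function.mem_support.1 hx])] at hsum
  have hsub : insert x₀ T ⊆ S := Finset.insert_subset_insert _ Finset.subset_union_right
  have hle : ∑ x ∈ insert x₀ T, torusOrder L g x ≤ ∑ x ∈ S, torusOrder L g x :=
    Finset.sum_le_sum_of_subset_of_nonneg hsub fun x _ hx => hnonneg x (by
      rintro rfl
      exact hx (Finset.mem_insert_self _ _))
  rw [hsum, Finset.sum_insert hx₀T, h0] at hle
  have := Finset.card_nsmul_le_sum T _ 1 hpos
  rw [hTcard, nsmul_eq_mul, mul_one] at this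
  have : (2 : ℤ) < Fintype.card ι := by exact_mod_cast hcard
  linarith

end

/-! ### Splitting of multiple zeros under a transversal perturbation. -/

theorem isInvertible_of_apply_one_ne_zero {A : ℂ →L[ℂ] ℂ} (h : A 1 ≠ 0) : A.IsInvertible := by
  refine ⟨ContinuousLinearEquiv.unitsEquivAut ℂ (Units.mk0 (A 1) h), ?_⟩
  ext
  simp

theorem hasDerivAt_left {H : ℂ × ℂ → ℂ} {u : ℂ × ℂ} (h : DifferentiableAt ℂ H u) :
    HasDerivAt (fun z => H (z, u.2)) (fderiv ℂ H u (1, 0)) u.1 :=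
  h.hasFDerivAt.comp_hasDerivAt (f := fun z : ℂ => (z, u.2)) u.1
    ((hasDerivAt_id u.1).prodMk (hasDerivAt_const u.1 u.2))

theorem hasDerivAt_right {H : ℂ × ℂ → ℂ} {u : ℂ × ℂ} (h : DifferentiableAt ℂ H u) :
    HasDerivAt (fun s => H (u.1, s)) (fderiv ℂ H u (0, 1)) u.2 :=
  h.hasFDerivAt.comp_hasDerivAt (f := fun s : ℂ => (u.1, s)) u.2
    ((hasDerivAt_const u.2 u.1).prodMk (hasDerivAt_id u.2))

/-- A zero of `H (·, 0)` at which the derivative of `H` with respect to the parameter does not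
vanish splits into simple zeros for nonzero parameters. -/
theorem eventually_eq_zero_of_multiple_zero {H : ℂ × ℂ → ℂ} {z₀ : ℂ} (hH : AnalyticAt ℂ H (z₀, 0))
    (h0 : H (z₀, 0) = 0) (hs : deriv (fun s => H (z₀, s)) 0 ≠ 0)
    (hnz : ¬ ∀ᶠ z in 𝓝 z₀, H (z, 0) = 0) :
    ∀ᶠ u in 𝓝 (z₀, (0 : ℂ)), H u = 0 → deriv (fun z => H (z, u.2)) u.1 = 0 → u.2 = 0 := by
  have hs' : fderiv ℂ H (z₀, 0) (0, 1) ≠ 0 := by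
    rwa [← (hasDerivAt_right hH.differentiableAt).deriv]
  have hinv : (fderiv ℂ H (z₀, 0) ∘L .inr ℂ ℂ ℂ).IsInvertible :=
    isInvertible_of_apply_one_ne_zero (by simpa using hs')
  have hc : ContDiffAt ℂ 1 H (z₀, 0) := hH.contDiffAt
  -- Since the parameter derivative is nonzero, the zero set of `H` near `(z₀, 0)` is the graph `s =
  -- S z`, solved for the parameter rather than for `z`.
  set S := hc.implicitFunction one_ne_zero hinv with hS
  have hS0 : S z₀ = 0 := hc.implicitFunction_apply_self one_ne_zero hinv
  have hSd : ∀ᶠ z in 𝓝 z₀, DifferentiableAt ℂ S z := by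
    have := (hc.contDiffAt_implicitFunction one_ne_zero hinv).eventually (by simp)
    filter_upwards [this] with z hz using hz.differentiableAt (by simp)
  have hSa : AnalyticAt ℂ S z₀ := analyticAt_iff_eventually_differentiableAt.2 hSd
  have hgraph := hc.eventually_apply_eq_iff_implicitFunction one_ne_zero hinv
  have hzero := hc.eventually_apply_implicitFunction one_ne_zero hinv
  rw [h0] at hzero hgraph
  have hpair : Tendsto (fun z => (z, S z)) (𝓝 z₀) (𝓝 (z₀, 0)) := by
    have : Tendsto S (𝓝 z₀) (𝓝 0) := by
      rw [← hS0]
      exact hSa.continuousAt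
    exact tendsto_id.prodMk_nhds this
  have hpart : ∀ᶠ u in 𝓝 (z₀, (0 : ℂ)), fderiv ℂ H u (0, 1) ≠ 0 := by
    have hcont : ContinuousAt (fun u => fderiv ℂ H u (0, 1)) (z₀, 0) :=
      hH.fderiv.continuousAt.clm_apply continuousAt_const
    exact hcont.eventually_ne hs'
  -- Differentiating `H (z, S z) = 0` gives `∂H/∂z + S' * ∂H/∂s = 0`, so multiple zeros lie over
  -- critical points of `S`.
  have hchain : ∀ᶠ z in 𝓝 z₀, deriv (fun ζ => H (ζ, S z)) z = 0 → deriv S z = 0 := by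
    filter_upwards [hzero.eventually_nhds, hSd, hpair.eventually hpart,
      hpair.eventually hH.eventually_analyticAt] with z h₁ h₂ h₃ h₄ h₅
    have hcomp : HasDerivAt (fun ζ => H (ζ, S ζ)) (fderiv ℂ H (z, S z) (1, deriv S z)) z :=
      h₄.differentiableAt.hasFDerivAt.comp_hasDerivAt (f := fun ζ : ℂ => (ζ, S ζ)) z
        ((hasDerivAt_id z).prodMk h₂.hasDerivAt)
    have e0 : fderiv ℂ H (z, S z) (1, deriv S z) = 0 := by
      rw [← hcomp.deriv, EventuallyEq.deriv_eq (f := fun _ => (0 : ℂ)) h₁, deriv_const]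
    have e1 := (hasDerivAt_left h₄.differentiableAt).deriv
    dsimp only at e1
    rw [h₅] at e1
    have e2 : ((1 : ℂ), deriv S z) = (1, 0) + deriv S z • (0, 1) := by simp
    rw [e2, map_add, map_smul, ← e1, zero_add, smul_eq_mul] at e0
    exact (mul_eq_zero.1 e0).resolve_right h₃
  -- Critical points of `S` are isolated; otherwise `S` would be constantly `0` near `z₀` and `H (·,
  -- 0)` would vanish there. The only multiple zero left is over `z₀`, where the parameter is `S z₀
  -- = 0`.
  have hcrit : ∀ᶠ z in 𝓝[≠] z₀, deriv S z ≠ 0 := by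
    refine (hSa.deriv.eventually_eq_zero_or_eventually_ne_zero).resolve_left fun hz => hnz ?_
    obtain ⟨r, hr, hball⟩ := Metric.eventually_nhds_iff_ball.1 (hz.and (hSd.and hzero))
    refine Metric.eventually_nhds_iff_ball.2 ⟨r, hr, fun z hzr => ?_⟩
    have : S z = S z₀ := by
      refine (convex_ball z₀ r).is_const_of_fderivWithin_eq_zero (𝕜 := ℂ)
        (fun x hx => (hball x hx).2.1.differentiableWithinAt) (fun x hx => ?_) hzr
        (Metric.mem_ball_self hr)
      rw [fderivWithin_of_isOpen Metric.isOpen_ball hx]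
      ext
      simpa using (hball x hx).1
    have e := (hball z hzr).2.2
    change H (z, S z) = 0 at e
    rwa [this, hS0] at e
  have hcrit' := eventually_nhdsWithin_iff.1 hcrit
  have hfst : Tendsto Prod.fst (𝓝 (z₀, (0 : ℂ))) (𝓝 z₀) := continuousAt_fst
  filter_upwards [hgraph, hfst.eventually hcrit', hfst.eventually hchain] with u h₁ h₂ h₃ h₄ h₅
  have hu : S u.1 = u.2 := h₁.1 h₄
  by_contra hne
  have hd := h₃ (by rw [hu]; exact h₅)
  refine h₂ ?_ hd
  rintro (h : u.1 = z₀)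
  rw [h, hS0] at hu
  exact hne hu.symm

/-! ### Perturbing the logarithmic derivative along a direction of divisors. -/

/-- A linear combination of translates of the logarithmic derivative of `θ`, as a function of the
variable and of the parameter that moves the poles in the direction `v`. -/
noncomputable def zetaSum {ι : Type*} [Fintype ι] (θ : ℂ → ℂ) (p : ι → ℂ) (w : ι → ℤ) (v : ι → ℂ)
    (c : ℂ) (u : ℂ × ℂ) : ℂ :=
  ∑ k, (w k : ℂ) * logDeriv θ (u.1 - (p k + u.2 * v k)) + c

section

variable {L : PeriodPair} {ω₁ ω₂ κ μ : ℂ} {θ : ℂ → ℂ} {ι : Type*} [Fintype ι]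
  {p : ι → ℂ} {w : ι → ℤ} {v : ι → ℂ} {c : ℂ}

theorem eventually_notMem_lattice {z : ℂ} (hz : z ∉ L.lattice) : ∀ᶠ u in 𝓝 z, u ∉ L.lattice :=
  L.isClosed_lattice.isOpen_compl.mem_nhds hz

theorem IsTheta.analyticAt_zetaSum (hθ : IsTheta L ω₁ ω₂ κ μ θ) {u : ℂ × ℂ}
    (hu : ∀ k, u.1 - (p k + u.2 * v k) ∉ L.lattice) : AnalyticAt ℂ (zetaSum θ p w v c) u := by
  refine (Finset.univ.analyticAt_fun_sum fun k _ => ?_).add analyticAt_const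
  refine analyticAt_const.mul ?_
  exact (hθ.analyticAt_logDeriv (hu k)).comp_of_eq (f := fun u : ℂ × ℂ => u.1 - (p k + u.2 * v k))
    (analyticAt_fst.sub (analyticAt_const.add (analyticAt_snd.mul analyticAt_const))) rfl

theorem IsTheta.deriv_zetaSum_param (hθ : IsTheta L ω₁ ω₂ κ μ θ) {z : ℂ}
    (hz : ∀ k, z - p k ∉ L.lattice) :
    deriv (fun s => zetaSum θ p w v c (z, s)) 0 =
      -∑ k, (w k : ℂ) * v k * deriv (logDeriv θ) (z - p k) := by
  have h : ∀ k, HasDerivAt (fun s => logDeriv θ (z - (p k + s * v k)))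
      (deriv (logDeriv θ) (z - p k) * -(1 * v k)) 0 := by
    intro k
    have h₁ : HasDerivAt (logDeriv θ) (deriv (logDeriv θ) (z - p k)) (z - (p k + 0 * v k)) := by
      simpa using (hθ.analyticAt_logDeriv (hz k)).differentiableAt.hasDerivAt
    exact h₁.comp (0 : ℂ) ((((hasDerivAt_id (0 : ℂ)).mul_const (v k)).const_add (p k)).const_sub z)
  have := (HasDerivAt.fun_sum (u := Finset.univ) fun k _ => (h k).const_mul (w k : ℂ)).add_const c
  rw [show (fun s => zetaSum θ p w v c (z, s)) = fun s =>
    ∑ k, (w k : ℂ) * logDeriv θ (z - (p k + s * v k)) + c from rfl, this.deriv,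
    ← Finset.sum_neg_distrib]
  refine Finset.sum_congr rfl fun k _ => ?_
  ring

/-- Multiplying by `θ (d k₀ u)` removes the moving pole and leaves the function `M`, continuous at
`(z₀, 0)`, whose value there is `w k₀ * θ' ≠ 0`. Zeros thus stay away from the poles, uniformly for
small parameters. -/
theorem IsTheta.eventually_zetaSum_ne_zero (hθ : IsTheta L ω₁ ω₂ κ μ θ) (hw : ∀ k, w k ≠ 0)
    (hp : ∀ j k, p j - p k ∈ L.lattice → j = k) {z₀ : ℂ} {k₀ : ι} (hz₀ : z₀ - p k₀ ∈ L.lattice) :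
    ∀ᶠ u in 𝓝 (z₀, (0 : ℂ)), (∀ k, u.1 - (p k + u.2 * v k) ∉ L.lattice) →
      zetaSum θ p w v c u ≠ 0 := by
  classical
  set d : ι → ℂ × ℂ → ℂ := fun k u => u.1 - (p k + u.2 * v k) with hd
  have hd0 : ∀ k, d k (z₀, 0) = z₀ - p k := fun k => by simp [hd]
  have hdc : ∀ k, Continuous (d k) := fun k => by fun_prop
  set M : ℂ × ℂ → ℂ := fun u => (w k₀ : ℂ) * deriv θ (d k₀ u) +
    θ (d k₀ u) * (∑ k ∈ Finset.univ.erase k₀, (w k : ℂ) * logDeriv θ (d k u) + c) with hM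
  have hθ' : Continuous (deriv θ) := (hθ.diff.contDiff (n := 1)).continuous_deriv le_rfl
  have hcont : ContinuousAt M (z₀, 0) := by
    refine ((continuous_const.mul (hθ'.comp (hdc k₀))).continuousAt).add
      ((hθ.diff.continuous.comp (hdc k₀)).continuousAt.mul
        (ContinuousAt.add (tendsto_finsetSum _ fun k hk => ?_) continuousAt_const))
    refine (continuousAt_const.mul ?_ : ContinuousAt (fun u => (w k : ℂ) * logDeriv θ (d k u)) _)
    refine ContinuousAt.comp_of_eq (f := d k) ?_ (hdc k).continuousAt rfl
    rw [hd0]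
    refine (hθ.analyticAt_logDeriv fun h => Finset.ne_of_mem_erase hk ?_).continuousAt
    refine hp k k₀ ?_
    simpa using sub_mem hz₀ h
  have hne : M (z₀, 0) ≠ 0 := by
    simp only [hM, hd0, (hθ.zero_iff _).2 hz₀, zero_mul, add_zero]
    exact mul_ne_zero (by exact_mod_cast hw k₀) (hθ.deriv_ne _ hz₀)
  filter_upwards [hcont.eventually_ne hne] with u hu hgen h0
  refine hu ?_
  have hθne : θ (d k₀ u) ≠ 0 := mt (hθ.zero_iff _).1 (hgen k₀)
  have : M u = θ (d k₀ u) * zetaSum θ p w v c u := by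
    rw [zetaSum, ← Finset.add_sum_erase _ _ (Finset.mem_univ k₀)]
    simp only [hM, hd, logDeriv_apply] at hθne ⊢
    field_simp
    ring
  rw [this, h0, mul_zero]

theorem eventually_generic (q : ι → ℂ) {z : ℂ} (hz : ∀ k, z - q k ∉ L.lattice) :
    ∀ᶠ u in 𝓝 z, ∀ k, u - q k ∉ L.lattice :=
  eventually_all.2 fun k =>
    (continuous_id.sub continuous_const).continuousAt.eventually (eventually_notMem_lattice (hz k))

theorem generic_add_iff {ι : Type*} {q : ι → ℂ} {z a : ℂ} (ha : a ∈ L.lattice) :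
    (∀ k, z + a - q k ∉ L.lattice) ↔ ∀ k, z - q k ∉ L.lattice := by
  refine forall_congr' fun k => not_congr ?_
  rw [add_sub_right_comm]
  exact Submodule.add_mem_iff_left _ ha

/-- The set of multiple zeros of a `zetaSum` is invariant under translations by lattice points. -/
theorem IsTheta.multiple_zero_add_iff (hθ : IsTheta L ω₁ ω₂ κ μ θ) (hw : ∑ k, w k = 0) (s : ℂ)
    {l : ℂ} (hl : l ∈ L.lattice) (z : ℂ) :
    ((∀ k, z + l - (p k + s * v k) ∉ L.lattice) ∧ zetaSum θ p w v c (z + l, s) = 0 ∧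
        deriv (fun z => zetaSum θ p w v c (z, s)) (z + l) = 0) ↔
      (∀ k, z - (p k + s * v k) ∉ L.lattice) ∧ zetaSum θ p w v c (z, s) = 0 ∧
        deriv (fun z => zetaSum θ p w v c (z, s)) z = 0 := by
  have step : ∀ a ∈ L.lattice, ∀ η : ℂ,
      (∀ z ∉ L.lattice, logDeriv θ (z + a) = logDeriv θ z + η) → ∀ z,
      ((∀ k, z + a - (p k + s * v k) ∉ L.lattice) ∧ zetaSum θ p w v c (z + a, s) = 0 ∧
        deriv (fun z => zetaSum θ p w v c (z, s)) (z + a) = 0) ↔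
      (∀ k, z - (p k + s * v k) ∉ L.lattice) ∧ zetaSum θ p w v c (z, s) = 0 ∧
        deriv (fun z => zetaSum θ p w v c (z, s)) z = 0 := by
    intro a ha η hη z
    rw [generic_add_iff ha]
    refine and_congr_right fun hz => ?_
    have key : ∀ u, (∀ k, u - (p k + s * v k) ∉ L.lattice) →
        zetaSum θ p w v c (u + a, s) = zetaSum θ p w v c (u, s) := by
      intro u hu
      simp only [zetaSum]
      -- Each summand changes by `w k * η`, and these increments cancel because the degree is zero.
      have hw' : ∑ k, (w k : ℂ) = 0 := by exact_mod_cast hw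
      have : ∀ k, (w k : ℂ) * logDeriv θ (u + a - (p k + s * v k)) =
          (w k : ℂ) * logDeriv θ (u - (p k + s * v k)) + (w k : ℂ) * η := fun k => by
        rw [add_sub_right_comm, hη _ (hu k), mul_add]
      simp only [this, Finset.sum_add_distrib, ← Finset.sum_mul, hw', zero_mul, add_zero]
    have hev : (fun u => zetaSum θ p w v c (u + a, s)) =ᶠ[𝓝 z]
        fun u => zetaSum θ p w v c (u, s) := by
      filter_upwards [eventually_generic _ hz] with u hu using key u hu
    rw [key z hz, ← deriv_comp_add_const, hev.deriv_eq]
  obtain ⟨m, n, rfl⟩ := (hθ.mem_iff l).1 hl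
  exact invariant_of_basis (P := fun z => (∀ k, z - (p k + s * v k) ∉ L.lattice) ∧
    zetaSum θ p w v c (z, s) = 0 ∧ deriv (fun z => zetaSum θ p w v c (z, s)) z = 0)
    (step ω₁ hθ.ω₁_mem 0 fun z _ => by rw [hθ.logDeriv_add₁, add_zero])
    (step ω₂ hθ.ω₂_mem κ fun z hz => hθ.logDeriv_add₂ hz) m n z

/-- If the direction `v` is transversal at all zeros of `zetaSum θ p w v c (·, 0)`, then for small
nonzero parameters all zeros are simple. -/
theorem IsTheta.eventually_simple_zeros (hθ : IsTheta L ω₁ ω₂ κ μ θ) (hw : ∀ k, w k ≠ 0)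
    (hsum : ∑ k, w k = 0) (hp : ∀ j k, p j - p k ∈ L.lattice → j = k)
    (hnz : ∀ z, (∀ k, z - p k ∉ L.lattice) → ¬ ∀ᶠ u in 𝓝 z, zetaSum θ p w v c (u, 0) = 0)
    (hv : ∀ z, (∀ k, z - p k ∉ L.lattice) → zetaSum θ p w v c (z, 0) = 0 →
      ∑ k, (w k : ℂ) * v k * deriv (logDeriv θ) (z - p k) ≠ 0) :
    ∀ᶠ s in 𝓝[≠] (0 : ℂ), ∀ z, (∀ k, z - (p k + s * v k) ∉ L.lattice) →
      zetaSum θ p w v c (z, s) = 0 → deriv (fun z => zetaSum θ p w v c (z, s)) z ≠ 0 := by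
  obtain ⟨K, hK, hred⟩ := exists_compact_reps L
  -- Locally a multiple zero forces the parameter to be `0`, whether `z₀` is a zero, a regular
  -- nonzero point or a pole at parameter `0`. Compactness of `K` gives one neighbourhood of
  -- parameters, and lattice translations extend the result to all `z`.
  have hloc : ∀ z₀ ∈ K, ∀ᶠ u : ℂ × ℂ in 𝓝 ((0 : ℂ), z₀),
      (∀ k, u.2 - (p k + u.1 * v k) ∉ L.lattice) → zetaSum θ p w v c (u.2, u.1) = 0 →
        deriv (fun z => zetaSum θ p w v c (z, u.1)) u.2 = 0 → u.1 = 0 := by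
    intro z₀ _
    have hswap : Tendsto Prod.swap (𝓝 ((0 : ℂ), z₀)) (𝓝 (z₀, (0 : ℂ))) :=
      continuous_swap.continuousAt
    by_cases hgen : ∀ k, z₀ - p k ∉ L.lattice
    · have ha : AnalyticAt ℂ (zetaSum θ p w v c) (z₀, 0) :=
        hθ.analyticAt_zetaSum (by simpa using hgen)
      by_cases h0 : zetaSum θ p w v c (z₀, 0) = 0
      · have := eventually_eq_zero_of_multiple_zero ha h0
          (by rw [hθ.deriv_zetaSum_param hgen]; exact neg_ne_zero.2 (hv z₀ hgen h0)) (hnz z₀ hgen)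
        filter_upwards [hswap.eventually this] with u hu _ h₁ h₂ using hu h₁ h₂
      · filter_upwards [hswap.eventually (ha.continuousAt.eventually_ne h0)] with u hu _ h₁
        exact absurd h₁ hu
    · push Not at hgen
      obtain ⟨k₀, hk₀⟩ := hgen
      filter_upwards [hswap.eventually (hθ.eventually_zetaSum_ne_zero (v := v) (c := c) hw hp hk₀)]
        with u hu hg h₁
      exact absurd h₁ (hu hg)
  have := hK.eventually_forall_of_forall_eventually (x₀ := (0 : ℂ))
    (P := fun s z => (∀ k, z - (p k + s * v k) ∉ L.lattice) → zetaSum θ p w v c (z, s) = 0 →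
        deriv (fun z => zetaSum θ p w v c (z, s)) z = 0 → s = 0) hloc
  rw [eventually_nhdsWithin_iff]
  filter_upwards [this] with s hs hs0 z hz h0 hd
  obtain ⟨l, hl, hzl⟩ := hred z
  have := (hθ.multiple_zero_add_iff (p := p) (v := v) (c := c) hsum s (neg_mem hl) z).2 ⟨hz, h0, hd⟩
  rw [← sub_eq_add_neg] at this
  exact hs0 (hs _ hzl this.1 this.2.1 this.2.2)

/-- There is a direction in the space of divisors that is transversal at all zeros of the
logarithmic derivative of an elliptic function. -/
theorem IsTheta.exists_transversal (hθ : IsTheta L ω₁ ω₂ κ μ θ) (hw : ∀ k, w k ≠ 0)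
    (hp : ∀ j k, p j - p k ∈ L.lattice → j = k) (hcard : 2 < Fintype.card ι)
    {Z : Set ℂ} (hZ : ∀ z ∈ Z, ∀ k, z - p k ∉ L.lattice)
    (hfin : ((Submodule.Quotient.mk (p := L.lattice)) '' Z).Finite) :
    ∃ v : ι → ℂ, ∑ k, (w k : ℂ) * v k = 0 ∧
      ∀ z ∈ Z, ∑ k, (w k : ℂ) * v k * deriv (logDeriv θ) (z - p k) ≠ 0 := by
  classical
  set Φ : (ι → ℂ) →ₗ[ℂ] ℂ := ∑ k, (w k : ℂ) • LinearMap.proj k with hΦ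
  have hΦa : ∀ v, Φ v = ∑ k, (w k : ℂ) * v k := fun v => by simp [hΦ]
  -- Up to sign, `Ψ z` is the velocity of the perturbed logarithmic derivative at `z`; `ker Φ`
  -- consists of the directions that preserve the weighted sum of the divisor.
  set Ψ : ℂ → (ι → ℂ) →ₗ[ℂ] ℂ := fun z =>
    ∑ k, ((w k : ℂ) * deriv (logDeriv θ) (z - p k)) • LinearMap.proj k with hΨ
  have hΨa : ∀ z v, Ψ z v = ∑ k, (w k : ℂ) * v k * deriv (logDeriv θ) (z - p k) := fun z v => by
    simp only [hΨ, LinearMap.sum_apply, LinearMap.smul_apply, LinearMap.proj_apply, smul_eq_mul]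
    exact Finset.sum_congr rfl fun k _ => by ring
  have hΨper : ∀ z z', z - z' ∈ L.lattice → Ψ z = Ψ z' := by
    intro z z' h
    ext1
    simp only [hΨ]
    congr 1
    refine Finset.sum_congr rfl fun k _ => ?_
    have := hθ.periodic_deriv_logDeriv _ h (z' - p k)
    rw [show z' - p k + (z - z') = z - p k by ring] at this
    rw [this]
  set F : ℂ ⧸ L.lattice → Submodule ℂ (LinearMap.ker Φ) := fun x =>
    LinearMap.ker ((Ψ (Quotient.out x)).comp (LinearMap.ker Φ).subtype) with hF
  have htop : (⊤ : Submodule ℂ (LinearMap.ker Φ)) ∉ hfin.toFinset.image F := by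
    intro h
    obtain ⟨x, hx, hxt⟩ := Finset.mem_image.1 h
    obtain ⟨z, hz, rfl⟩ := hfin.mem_toFinset.1 hx
    have hker : ∀ v, Φ v = 0 → Ψ z v = 0 := by
      intro v hv
      rw [← hΨper _ z (mk_eq_mk_iff.1 (Submodule.Quotient.mk_out (Submodule.Quotient.mk z)))]
      have : (⟨v, hv⟩ : LinearMap.ker Φ) ∈ F (Submodule.Quotient.mk z) := by
        rw [hxt]
        trivial
      exact this
    have : Nonempty ι := Fintype.card_pos_iff.1 (by omega)
    let k₀ : ι := Classical.arbitrary ι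
    obtain ⟨k, hk⟩ := hθ.exists_deriv_logDeriv_ne hcard (hZ z hz) (fun j k h => by
      refine (hp k j ?_).symm
      simpa using h) (deriv (logDeriv θ) (z - p k₀))
    refine hk ?_
    have hwk : ∀ j, (w j : ℂ) ≠ 0 := fun j => by exact_mod_cast hw j
    -- This vector lies in `ker Φ`, and `Ψ z` maps it to the difference of the values of `deriv
    -- (logDeriv θ)` at `z - p k` and `z - p k₀`.
    have := hker (Pi.single k (w k : ℂ)⁻¹ - Pi.single k₀ (w k₀ : ℂ)⁻¹) (by
      rw [map_sub, hΦa, hΦa]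
      simp [Pi.single_apply, hwk])
    rw [map_sub, hΨa, hΨa] at this
    simp [Pi.single_apply, hwk] at this
    exact sub_eq_zero.1 this
  -- A vector space over an infinite field is not a finite union of proper subspaces.
  have hcover := Subspace.biUnion_ne_univ_of_top_notMem htop
  obtain ⟨v, hv⟩ := (Set.ne_univ_iff_exists_notMem _).1 hcover
  refine ⟨v, by rw [← hΦa]; exact v.2, fun z hz h0 => hv ?_⟩
  refine Set.mem_iUnion₂.2 ⟨F (Submodule.Quotient.mk z), Finset.mem_image_of_mem _
    (hfin.mem_toFinset.2 ⟨z, hz, rfl⟩), ?_⟩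
  show Ψ (Quotient.out (Submodule.Quotient.mk z : ℂ ⧸ L.lattice)) v = 0
  rw [hΨper _ z (mk_eq_mk_iff.1 (Submodule.Quotient.mk_out (Submodule.Quotient.mk z))), hΨa, h0]

end

/-! ### Elliptic functions with a prescribed divisor: existence and uniqueness. -/

section

variable {L : PeriodPair} {ω₁ ω₂ κ μ : ℂ} {θ : ℂ → ℂ} {ι : Type*} [Fintype ι]
  {p : ι → ℂ} {w : ι → ℤ} {q : ℂ → ℂ} {c : ℂ}

theorem HasDivisor.order_eq_zero {f : ℂ → ℂ} (hdiv : HasDivisor L f p w) {z : ℂ}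
    (hz : ∀ k, z - p k ∉ L.lattice) : meromorphicOrderAt f z = 0 := by
  classical
  rw [hdiv z, Finset.sum_eq_zero fun k _ => if_neg (hz k)]
  rfl

theorem HasDivisor.order_eq {f : ℂ → ℂ} (hdiv : HasDivisor L f p w)
    (hp : ∀ j k, p j - p k ∈ L.lattice → j = k) {z : ℂ} {k : ι} (hz : z - p k ∈ L.lattice) :
    meromorphicOrderAt f z = w k := by
  classical
  have : (∑ j, if z - p j ∈ L.lattice then w j else 0) = w k := by
    rw [Finset.sum_eq_single k (fun j _ hj => if_neg fun h => hj (hp j k (by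
      simpa using sub_mem hz h))) (by simp), if_pos hz]
  rw [hdiv z, ← this]

theorem eventually_generic_nhdsNE (L : PeriodPair) (p : ι → ℂ) (z : ℂ) :
    ∀ᶠ u in 𝓝[≠] z, ∀ k, u - p k ∉ L.lattice := by
  refine eventually_all.2 fun k => ?_
  have hmem : (↑L.lattice \ {z - p k})ᶜ ∈ 𝓝 (z - p k) :=
    L.compl_lattice_sdiff_singleton_mem_nhds _
  have : Tendsto (fun u => u - p k) (𝓝 z) (𝓝 (z - p k)) :=
    (continuous_id.sub continuous_const).continuousAt
  filter_upwards [nhdsWithin_le_nhds (this hmem), self_mem_nhdsWithin] with u hu hne h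
  exact hu ⟨h, fun e => hne (sub_left_injective e)⟩

/-- In degree zero the multiplier of the theta quotient along `ω₂` is `exp (-κ * ∑ w k * p k)`,
which the twist cancels. The twist sees the divisor only through this weighted sum, so it survives
every perturbation that keeps the sum. -/
theorem IsTwist.periodic_mul_thetaProd (hq : IsTwist ω₁ ω₂ κ q c (∑ k, (w k : ℂ) * p k))
    (hθ : IsTheta L ω₁ ω₂ κ μ θ) (hw : ∑ k, w k = 0) :
    ∀ l ∈ L.lattice, Function.Periodic (fun z => q z * thetaProd θ p w z) l := by
  have hw' : ∑ k, (w k : ℂ) = 0 := by exact_mod_cast hw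
  refine hθ.periodic (fun z => ?_) (fun z => ?_)
  · simp only [hq.add₁, hθ.thetaProd_add₁]
  · simp only [hq.add₂, hθ.thetaProd_add₂, hw']
    rw [mul_mul_mul_comm, ← Complex.exp_add]
    ring_nf
    simp

theorem IsTwist.hasDivisor_mul_thetaProd {ρ : ℂ} (hq : IsTwist ω₁ ω₂ κ q c ρ)
    (hθ : IsTheta L ω₁ ω₂ κ μ θ) : HasDivisor L (fun z => q z * thetaProd θ p w z) p w := fun z =>
  (meromorphicOrderAt_mul_of_ne_zero (hq.diff.analyticAt z) (hq.ne_zero z)).trans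
    (hθ.hasDivisor_thetaProd p w z)

theorem IsTwist.exists_isElliptic (hq : IsTwist ω₁ ω₂ κ q c (∑ k, (w k : ℂ) * p k))
    (hθ : IsTheta L ω₁ ω₂ κ μ θ) (hwne : ∀ k, w k ≠ 0) (hw : ∑ k, w k = 0)
    (hp : ∀ j k, p j - p k ∈ L.lattice → j = k) [Nonempty ι] :
    ∃ g, IsElliptic L g ∧ HasDivisor L g p w := by
  set E : ℂ → ℂ := fun z => q z * thetaProd θ p w z
  have hE : MeromorphicOn E Set.univ := fun z _ =>
    (hq.diff.analyticAt z).meromorphicAt.mul (hθ.meromorphic_thetaProd p w z)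
  set g := toMeromorphicNFOn E Set.univ
  have hnf : MeromorphicNFOn g Set.univ := meromorphicNFOn_toMeromorphicNFOn E Set.univ
  have hge : ∀ z, g =ᶠ[𝓝[≠] z] E := fun z =>
    hE.toMeromorphicNFOn_eq_self_on_nhdsNE (Set.mem_univ z)
  have hdiv : HasDivisor L g p w := fun z =>
    (meromorphicOrderAt_congr (hge z)).trans (hq.hasDivisor_mul_thetaProd hθ z)
  refine ⟨g, ⟨hnf, fun l hl z => ?_, ?_⟩, hdiv⟩
  · have h₁ : MeromorphicNFAt (g ∘ fun z => z + l) z :=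
      meromorphicNFAt_comp_add_const_iff_meromorphicNFAt.2 (hnf (Set.mem_univ _))
    refine ((h₁.eventuallyEq_nhdsNE_iff_eventuallyEq_nhds (hnf (Set.mem_univ z))).1
      ?_).eq_of_nhds
    filter_upwards [hge z, (tendsto_add_const_nhdsNE z l).eventually (hge (z + l))] with u h₁ h₂
    rw [Function.comp_apply, h₁, h₂]
    exact hq.periodic_mul_thetaProd hθ hw l hl u
  -- A constant has order `0` or `⊤`, whereas the order at `p k` is the nonzero integer `w k`.
  · intro a ha
    let k : ι := Classical.arbitrary ι
    have h := hdiv.order_eq hp (z := p k) (k := k) (by simp)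
    rw [ha] at h
    have h₂ : meromorphicOrderAt (fun _ : ℂ => a) (p k) ≠ 0 := by
      rw [h]
      exact_mod_cast hwne k
    by_cases ha0 : a = 0
    · have : meromorphicOrderAt (fun _ : ℂ => a) (p k) = ⊤ :=
        meromorphicOrderAt_eq_top_iff.2 (by simp [ha0])
      rw [h] at this
      exact WithTop.coe_ne_top this
    · exact h₂ ((analyticAt_const.meromorphicNFAt).meromorphicOrderAt_eq_zero_iff.2 ha0)

/-- The quotient of two twists with the same multipliers is entire and elliptic, hence constant.
This is what allows a statement about every `g` with the given divisor. -/
theorem IsTwist.eq_const_mul (hq : IsTwist ω₁ ω₂ κ q c (∑ k, (w k : ℂ) * p k))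
    (hθ : IsTheta L ω₁ ω₂ κ μ θ) {g : ℂ → ℂ} (hg : Meromorphic g)
    (hper : ∀ l ∈ L.lattice, Function.Periodic g l) (hdiv : HasDivisor L g p w) :
    ∃ C, C ≠ 0 ∧ ∀ z, g =ᶠ[𝓝[≠] z] fun u => C * (q u * thetaProd θ p w u) := by
  obtain ⟨-, q', c', hq', hg'⟩ := hθ.exists_elliptic_factor hg hper hdiv
  have hd : Differentiable ℂ fun z => q' z / q z := hq'.diff.fun_div hq.diff hq.ne_zero
  have hconst := eq_of_differentiable_of_periodic hd (hθ.periodic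
    (fun z => by simp only [hq.add₁, hq'.add₁])
    (fun z => by simp only [hq.add₂, hq'.add₂]; exact mul_div_mul_left _ _ (Complex.exp_ne_zero _)))
  refine ⟨q' 0 / q 0, div_ne_zero (hq'.ne_zero 0) (hq.ne_zero 0), fun z => ?_⟩
  filter_upwards [hg' z] with u hu
  rw [hu, ← hconst u 0, ← mul_assoc, div_mul_cancel₀ _ (hq.ne_zero u)]

theorem IsTwist.eventuallyEq_const_mul (hq : IsTwist ω₁ ω₂ κ q c (∑ k, (w k : ℂ) * p k))
    (hθ : IsTheta L ω₁ ω₂ κ μ θ) {g : ℂ → ℂ} (hg : IsElliptic L g) (hdiv : HasDivisor L g p w) :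
    ∃ C, C ≠ 0 ∧ ∀ z, (∀ k, z - p k ∉ L.lattice) →
      g =ᶠ[𝓝 z] fun u => C * (q u * thetaProd θ p w u) := by
  obtain ⟨C, hC, h⟩ := hq.eq_const_mul hθ (fun z => (hg.meromorphic (Set.mem_univ z)).meromorphicAt)
    hg.periodic hdiv
  refine ⟨C, hC, fun z hz => ?_⟩
  have ha : AnalyticAt ℂ (fun u => C * (q u * thetaProd θ p w u)) z :=
    analyticAt_const.fun_mul ((hq.diff.analyticAt z).fun_mul (hθ.analyticAt_thetaProd w hz))
  exact ((hg.meromorphic (Set.mem_univ z)).eventuallyEq_nhdsNE_iff_eventuallyEq_nhds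
    ha.meromorphicNFAt).1 (h z)

theorem IsTwist.logDeriv_eq_sum (hq : IsTwist ω₁ ω₂ κ q c (∑ k, (w k : ℂ) * p k))
    (hθ : IsTheta L ω₁ ω₂ κ μ θ) {g : ℂ → ℂ} (hg : IsElliptic L g) (hdiv : HasDivisor L g p w)
    {z : ℂ} (hz : ∀ k, z - p k ∉ L.lattice) :
    logDeriv g z = ∑ k, (w k : ℂ) * logDeriv θ (z - p k) + c := by
  obtain ⟨C, hC, h⟩ := hq.eventuallyEq_const_mul hθ hg hdiv
  rw [(logDeriv_congr_nhds (h z hz)).eq_of_nhds, logDeriv_const_mul z C hC,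
    logDeriv_mul z (hq.ne_zero z) (hθ.thetaProd_ne_zero w hz) (hq.diff z)
      (hθ.analyticAt_thetaProd w hz).differentiableAt, hq.logDeriv_eq, hθ.logDeriv_thetaProd w hz,
    add_comm]

end

/-! ### Saddles of the Newton flow: hyperbolicity and number. -/

theorem det_smul_conj_mul (a b : ℂ) :
    ((a • ((conjCLE : ℂ →L[ℝ] ℂ).comp
      ((ContinuousLinearMap.toSpanSingleton ℂ b).restrictScalars ℝ)) : ℂ →L[ℝ] ℂ)).det =
      -(normSq a * normSq b) := by
  rw [ContinuousLinearMap.det, ← LinearMap.det_toMatrix Complex.basisOneI, Matrix.det_fin_two]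
  simp [LinearMap.toMatrix_apply, Complex.normSq_apply]
  ring

/-- The field is `φ * conj g'`. At a zero of `g'` only the derivative of the second factor survives,
so the Jacobi matrix is `h ↦ φ z * conj (g'' z * h)`, which reverses orientation. -/
theorem isHyperbolicSaddle_newtonField {g : ℂ → ℂ} {z : ℂ} (ha : AnalyticAt ℂ g z) (h0 : g z ≠ 0)
    (h₁ : deriv g z = 0) (h₂ : deriv (deriv g) z ≠ 0) :
    IsHyperbolicSaddle (newtonField g) z := by
  set φ : ℂ → ℂ := fun u => -((1 + ‖g u‖ ^ 4 : ℝ) : ℂ)⁻¹ * g u with hφ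
  have hpos : (0 : ℝ) < 1 + ‖g z‖ ^ 4 := by positivity
  have hgd : DifferentiableAt ℝ g z := ha.differentiableAt.restrictScalars ℝ
  have hφd : DifferentiableAt ℝ φ z := by
    have hn : DifferentiableAt ℝ (fun u => (1 + ‖g u‖ ^ 4 : ℝ)) z := by
      have e : (fun u => (1 + ‖g u‖ ^ 4 : ℝ)) = fun u => 1 + (‖g u‖ ^ 2) ^ 2 := by
        funext u
        ring
      rw [e]
      exact ((hgd.norm_sq ℝ).pow 2).const_add 1
    have hn' : DifferentiableAt ℝ (fun u => ((1 + ‖g u‖ ^ 4 : ℝ) : ℂ)) z :=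
      Complex.ofRealCLM.differentiableAt.comp z hn
    exact ((hn'.inv (by exact_mod_cast hpos.ne')).neg).mul hgd
  have hψ : HasFDerivAt (fun u => (starRingEnd ℂ) (deriv g u))
      ((conjCLE : ℂ →L[ℝ] ℂ).comp
        ((ContinuousLinearMap.toSpanSingleton ℂ (deriv (deriv g) z)).restrictScalars ℝ)) z :=
    (conjCLE : ℂ →L[ℝ] ℂ).hasFDerivAt.comp z
      (ha.deriv.differentiableAt.hasDerivAt.hasFDerivAt.restrictScalars ℝ)
  have hX : newtonField g = fun u => φ u * (starRingEnd ℂ) (deriv g u) := by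
    funext u
    simp only [newtonField, hφ]
    ring
  have hφ0 : φ z ≠ 0 :=
    mul_ne_zero (neg_ne_zero.2 (inv_ne_zero (by exact_mod_cast hpos.ne'))) h0
  refine ⟨by simp [hX, h₁], φ z • ((conjCLE : ℂ →L[ℝ] ℂ).comp
    ((ContinuousLinearMap.toSpanSingleton ℂ (deriv (deriv g) z)).restrictScalars ℝ)), ?_, ?_⟩
  · rw [hX]
    have := hφd.hasFDerivAt.fun_mul hψ
    simpa only [h₁, map_zero, zero_smul, add_zero] using this
  · rw [det_smul_conj_mul]
    exact neg_neg_of_pos (mul_pos (normSq_pos.2 hφ0) (normSq_pos.2 h₂))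

theorem analyticOrderAt_eq_one {f : ℂ → ℂ} {z : ℂ} (ha : AnalyticAt ℂ f z) (h0 : f z = 0)
    (h₁ : deriv f z ≠ 0) : analyticOrderAt f z = 1 := by
  have := ha.analyticOrderAt_sub_eq_one_of_deriv_ne_zero h₁
  simpa [h0] using this

section

variable {L : PeriodPair} {ι : Type*} [Fintype ι] {p : ι → ℂ} {w : ι → ℤ} {g : ℂ → ℂ}

theorem HasDivisor.generic_iff (hdiv : HasDivisor L g p w) (hw : ∀ k, w k ≠ 0)
    (hp : ∀ j k, p j - p k ∈ L.lattice → j = k) {z : ℂ} :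
    (∀ k, z - p k ∉ L.lattice) ↔ meromorphicOrderAt g z = 0 := by
  refine ⟨hdiv.order_eq_zero, fun h k hk => hw k ?_⟩
  rw [hdiv.order_eq hp hk] at h
  exact_mod_cast h

theorem mk_mem_saddles_iff (hg : IsElliptic L g) {z : ℂ} :
    Submodule.Quotient.mk z ∈ saddles hg ↔ meromorphicOrderAt g z = 0 ∧ deriv g z = 0 := by
  have hnf := hg.meromorphic (Set.mem_univ z)
  have hfield : g z ≠ 0 → (newtonField g z = 0 ↔ deriv g z = 0) := by
    intro h0
    have : ((1 + ‖g z‖ ^ 4 : ℝ) : ℂ) ≠ 0 := by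
      have : (0 : ℝ) < 1 + ‖g z‖ ^ 4 := by positivity
      exact_mod_cast this.ne'
    simp only [newtonField, mul_eq_zero, neg_eq_zero, inv_eq_zero, this, false_or, h0, or_false,
      map_eq_zero]
  constructor
  · rintro ⟨h₁, h₂⟩
    have h0 := h₂ z rfl
    exact ⟨h0, (hfield (hnf.meromorphicOrderAt_eq_zero_iff.1 h0)).1 h₁⟩
  · rintro ⟨h0, h₁⟩
    refine ⟨(hfield (hnf.meromorphicOrderAt_eq_zero_iff.1 h0)).2 h₁, fun u hu => ?_⟩
    rw [order_add_period hg.periodic (mk_eq_mk_iff.1 hu), h0]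

theorem deriv_logDeriv_of_deriv_eq_zero {z : ℂ} (ha : AnalyticAt ℂ g z) (h0 : g z ≠ 0)
    (h₁ : deriv g z = 0) : deriv (logDeriv g) z = deriv (deriv g) z / g z := by
  have : HasDerivAt (logDeriv g) _ z :=
    ha.deriv.differentiableAt.hasDerivAt.div ha.differentiableAt.hasDerivAt h0
  rw [this.deriv, h₁]
  field_simp
  ring

theorem IsElliptic.meromorphic' (hg : IsElliptic L g) : Meromorphic g := fun z =>
  (hg.meromorphic (Set.mem_univ z)).meromorphicAt

theorem IsElliptic.analyticAt_and_ne_zero (hg : IsElliptic L g) {z : ℂ}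
    (h : meromorphicOrderAt g z = 0) : AnalyticAt ℂ g z ∧ g z ≠ 0 :=
  have hnf := hg.meromorphic (Set.mem_univ z)
  ⟨hnf.meromorphicOrderAt_nonneg_iff_analyticAt.1 h.ge, hnf.meromorphicOrderAt_eq_zero_iff.1 h⟩

theorem IsElliptic.periodic_logDeriv (hg : IsElliptic L g) :
    ∀ l ∈ L.lattice, Function.Periodic (logDeriv g) l := by
  intro l hl z
  rw [logDeriv_apply, logDeriv_apply, ← deriv_comp_add_const, hg.periodic l hl,
    funext (hg.periodic l hl)]

theorem HasDivisor.order_logDeriv (hdiv : HasDivisor L g p w) (hg : Meromorphic g)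
    (hw : ∀ k, w k ≠ 0) (hp : ∀ j k, p j - p k ∈ L.lattice → j = k) (k : ι) :
    meromorphicOrderAt (logDeriv g) (p k) = (-1 : ℤ) := by
  have := hdiv.order_eq hp (z := p k) (k := k) (by simp)
  exact meromorphicOrderAt_logDeriv_eq_neg_one (hg _)
    (by rw [this]; exact_mod_cast hw k) (by rw [this]; exact WithTop.coe_ne_top)

theorem HasDivisor.order_logDeriv_ne_top (hdiv : HasDivisor L g p w) (hg : Meromorphic g)
    (hw : ∀ k, w k ≠ 0) (hp : ∀ j k, p j - p k ∈ L.lattice → j = k) [Nonempty ι] (z : ℂ) :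
    meromorphicOrderAt (logDeriv g) z ≠ ⊤ :=
  MeromorphicOn.meromorphicOrderAt_ne_top_of_isPreconnected (U := Set.univ)
    (x := p (Classical.arbitrary ι)) (fun u _ => (hg u).logDeriv) isPreconnected_univ
    (Set.mem_univ _) (Set.mem_univ _)
    (by rw [hdiv.order_logDeriv hg hw hp]; exact WithTop.coe_ne_top)

/-- On the torus, the order of `logDeriv g` is the indicator function of the saddles minus that of
the divisor points. The orders add up to zero, so the two sets have the same number of elements. -/
theorem ncard_saddles (hg : IsElliptic L g) (hdiv : HasDivisor L g p w) (hw : ∀ k, w k ≠ 0)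
    (hp : ∀ j k, p j - p k ∈ L.lattice → j = k) [Nonempty ι]
    (hsimple : ∀ z, (∀ k, z - p k ∉ L.lattice) → logDeriv g z = 0 → deriv (logDeriv g) z ≠ 0) :
    (saddles hg).ncard = Fintype.card ι := by
  classical
  set h := logDeriv g with hh
  have hm : Meromorphic h := hg.meromorphic'.logDeriv
  have hper := hg.periodic_logDeriv
  have hpole : ∀ k, meromorphicOrderAt h (p k) = (-1 : ℤ) :=
    hdiv.order_logDeriv hg.meromorphic' hw hp
  have hne := hdiv.order_logDeriv_ne_top hg.meromorphic' hw hp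
  have hreg : ∀ z, (∀ k, z - p k ∉ L.lattice) → AnalyticAt ℂ g z ∧ g z ≠ 0 := fun z hz =>
    hg.analyticAt_and_ne_zero (hdiv.order_eq_zero hz)
  set P : Finset (ℂ ⧸ L.lattice) :=
    Finset.univ.image fun k => (Submodule.Quotient.mk (p k) : ℂ ⧸ L.lattice) with hP
  have hPcard : P.card = Fintype.card ι :=
    Finset.card_image_of_injective _ fun j k e => hp j k (mk_eq_mk_iff.1 e)
  have hPmem : ∀ z, (Submodule.Quotient.mk z : ℂ ⧸ L.lattice) ∈ P ↔
      ∃ k, z - p k ∈ L.lattice := by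
    intro z
    simp only [hP, Finset.mem_image, Finset.mem_univ, true_and]
    exact exists_congr fun k => by rw [eq_comm, mk_eq_mk_iff]
  have hord : ∀ x, torusOrder L h x =
      (if x ∈ saddles hg then 1 else 0) - if x ∈ P then 1 else 0 := by
    intro x
    obtain ⟨z, rfl⟩ := Submodule.Quotient.mk_surjective _ x
    rw [torusOrder_mk hper]
    have hS := mk_mem_saddles_iff hg (z := z)
    by_cases hz : ∀ k, z - p k ∉ L.lattice
    · obtain ⟨ha, h0⟩ := hreg z hz
      have hha : AnalyticAt ℂ h z := ha.deriv.div ha h0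
      rw [if_neg (c := _ ∈ P) (by simpa [hPmem] using hz)]
      by_cases h₁ : deriv g z = 0
      · have hz0 : h z = 0 := by rw [hh, logDeriv_apply, h₁, zero_div]
        rw [if_pos (hS.2 ⟨hdiv.order_eq_zero hz, h₁⟩), hha.meromorphicOrderAt_eq,
          analyticOrderAt_eq_one hha hz0 (hsimple z hz hz0)]
        rfl
      · have hz0 : h z ≠ 0 := div_ne_zero h₁ h0
        rw [if_neg fun e => h₁ (hS.1 e).2, hha.meromorphicNFAt.meromorphicOrderAt_eq_zero_iff.2 hz0]
        rfl
    · have hz' : ¬ meromorphicOrderAt g z = 0 := mt (hdiv.generic_iff hw hp).2 hz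
      push Not at hz
      obtain ⟨k, hk⟩ := hz
      rw [if_neg fun e => hz' (hS.1 e).1, if_pos ((hPmem z).2 ⟨k, hk⟩), order_add_period hper hk, hpole]
      rfl
  have hdisj : ∀ x ∈ P, x ∉ saddles hg := by
    intro x hx
    obtain ⟨z, rfl⟩ := Submodule.Quotient.mk_surjective _ x
    rw [mk_mem_saddles_iff]
    rintro ⟨h0, -⟩
    obtain ⟨k, hk⟩ := (hPmem z).1 hx
    exact (hdiv.generic_iff hw hp).2 h0 k hk
  have hfin := finite_support_torusOrder hm hper
  have hSfin : (saddles hg).Finite := hfin.subset fun x hx => by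
    rw [Function.mem_support, hord, if_pos hx, if_neg fun hP => hdisj x hP hx]
    decide
  have hsum := finsum_torusOrder hm hper hne
  rw [finsum_eq_sum_of_support_subset _ (s := hSfin.toFinset ∪ P) (by
    intro x hx
    rw [Function.mem_support, hord] at hx
    by_contra hx'
    simp only [Finset.coe_union, Set.Finite.coe_toFinset, Set.mem_union, not_or] at hx'
    exact hx (by rw [if_neg hx'.1, if_neg fun e => hx'.2 (Finset.mem_coe.2 e), sub_zero]))] at hsum
  simp only [hord, Finset.sum_sub_distrib] at hsum
  have e₁ : ∑ x ∈ hSfin.toFinset ∪ P, (if x ∈ saddles hg then (1 : ℤ) else 0) =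
      hSfin.toFinset.card := by
    rw [Finset.sum_ite, Finset.sum_const_zero, add_zero, Finset.sum_const, nsmul_eq_mul, mul_one]
    congr 2
    ext x
    simp +contextual
  have e₂ : ∑ x ∈ hSfin.toFinset ∪ P, (if x ∈ P then (1 : ℤ) else 0) = P.card := by
    rw [Finset.sum_ite, Finset.sum_const_zero, add_zero, Finset.sum_const, nsmul_eq_mul, mul_one]
    congr 2
    ext x
    simp +contextual
  rw [e₁, e₂, hPcard] at hsum
  rw [Set.ncard_eq_toFinset_card _ hSfin]
  exact_mod_cast sub_eq_zero.1 hsum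

theorem isFoldSaddle_of_simple (hg : IsElliptic L g) (hdiv : HasDivisor L g p w)
    (hw : ∀ k, w k ≠ 0) (hp : ∀ j k, p j - p k ∈ L.lattice → j = k)
    (hsimple : ∀ z, (∀ k, z - p k ∉ L.lattice) → logDeriv g z = 0 → deriv (logDeriv g) z ≠ 0)
    {z : ℂ} (hz : Submodule.Quotient.mk z ∈ saddles hg) :
    IsFoldSaddle g 1 z ∧ IsHyperbolicSaddle (newtonField g) z := by
  obtain ⟨h0, h₁⟩ := (mk_mem_saddles_iff hg).1 hz
  obtain ⟨ha, hne⟩ := hg.analyticAt_and_ne_zero h0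
  have h₂ : deriv (deriv g) z ≠ 0 := by
    have := hsimple z ((hdiv.generic_iff hw hp).2 h0) (by rw [logDeriv_apply, h₁, zero_div])
    rw [deriv_logDeriv_of_deriv_eq_zero ha hne h₁] at this
    exact (div_ne_zero_iff.1 this).1
  exact ⟨⟨hz.1, ha, hne, analyticOrderAt_eq_one ha.deriv h₁ h₂⟩,
    isHyperbolicSaddle_newtonField ha hne h₁ h₂⟩

end

/-! ### Stability of periods and the choice of the perturbed divisor. -/

section

variable {L : PeriodPair} {ω₁ ω₂ κ μ : ℂ} {θ : ℂ → ℂ} {ι : Type*} [Fintype ι]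
  {p : ι → ℂ} {w : ι → ℤ} {q : ℂ → ℂ} {c : ℂ} {f : ℂ → ℂ}

theorem eventually_distinct (hp : ∀ j k, p j - p k ∈ L.lattice → j = k) (v : ι → ℂ) :
    ∀ᶠ s in 𝓝 (0 : ℂ), ∀ j k, p j + s * v j - (p k + s * v k) ∈ L.lattice → j = k := by
  refine eventually_all.2 fun j => eventually_all.2 fun k => ?_
  by_cases hjk : j = k
  · exact .of_forall fun _ _ => hjk
  have hc : Tendsto (fun s : ℂ => p j + s * v j - (p k + s * v k)) (𝓝 0) (𝓝 (p j - p k)) := by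
    have : Continuous fun s : ℂ => p j + s * v j - (p k + s * v k) := by fun_prop
    simpa using this.tendsto 0
  filter_upwards [hc.eventually (eventually_notMem_lattice fun h => hjk (hp j k h))] with s hs h
  exact absurd h hs

theorem IsTheta.continuousAt_thetaProd (hθ : IsTheta L ω₁ ω₂ κ μ θ) (v : ι → ℂ) {ζ : ℂ → ℂ}
    (hζ : Continuous ζ) (hgen : ∀ k, ζ 0 - p k ∉ L.lattice) :
    ContinuousAt (fun s => thetaProd θ (fun k => p k + s * v k) w (ζ s)) 0 := by
  refine tendsto_finsetProd _ fun k _ => ?_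
  have h : Continuous fun s => θ (ζ s - (p k + s * v k)) :=
    hθ.diff.continuous.comp (by fun_prop)
  refine (h.continuousAt (x := 0)).zpow₀ (w k) (Or.inl ?_)
  simpa using mt (hθ.zero_iff _).1 (hgen k)

/-- A translation which is not a period of `f` is not the limit of periods of perturbed
functions. -/
theorem IsTwist.eventually_not_periodic {ρ : ℂ} (hq : IsTwist ω₁ ω₂ κ q c ρ)
    (hθ : IsTheta L ω₁ ω₂ κ μ θ) (hf : MeromorphicNFOn f Set.univ)
    (hfq : ∀ z, f =ᶠ[𝓝[≠] z] fun u => q u * thetaProd θ p w u) (v : ι → ℂ) {r : ℂ → ℂ}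
    (hr : Continuous r) (hper : ¬ Function.Periodic f (r 0)) :
    ∀ᶠ s in 𝓝 (0 : ℂ), ∃ z, (∀ k, z - (p k + s * v k) ∉ L.lattice) ∧
      (∀ k, z + r s - (p k + s * v k) ∉ L.lattice) ∧
      q (z + r s) * thetaProd θ (fun k => p k + s * v k) w (z + r s) ≠
        q z * thetaProd θ (fun k => p k + s * v k) w z := by
  -- A witness of non-periodicity can be taken off the divisor and off its translate; otherwise
  -- equality at such points would extend to all of `ℂ` by normal forms. At a generic witness both
  -- sides are continuous in `s`, so they stay different.
  have hex : ∃ z, (∀ k, z - p k ∉ L.lattice) ∧ (∀ k, z + r 0 - p k ∉ L.lattice) ∧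
      q (z + r 0) * thetaProd θ p w (z + r 0) ≠ q z * thetaProd θ p w z := by
    by_contra! h
    refine hper fun z => ?_
    have h₁ : MeromorphicNFAt (f ∘ fun z => z + r 0) z :=
      meromorphicNFAt_comp_add_const_iff_meromorphicNFAt.2 (hf (Set.mem_univ _))
    refine ((h₁.eventuallyEq_nhdsNE_iff_eventuallyEq_nhds (hf (Set.mem_univ z))).1
      ?_).eq_of_nhds
    have ht := tendsto_add_const_nhdsNE z (r 0)
    filter_upwards [hfq z, ht.eventually (hfq (z + r 0)), eventually_generic_nhdsNE L p z,
      ht.eventually (eventually_generic_nhdsNE L p (z + r 0))] with u h₁ h₂ h₃ h₄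
    rw [Function.comp_apply, h₁, h₂, h u h₃ h₄]
  obtain ⟨z, h₁, h₂, h₃⟩ := hex
  have hgen : ∀ ζ : ℂ → ℂ, Continuous ζ → (∀ k, ζ 0 - p k ∉ L.lattice) →
      ∀ᶠ s in 𝓝 (0 : ℂ), ∀ k, ζ s - (p k + s * v k) ∉ L.lattice := by
    intro ζ hζ h
    refine eventually_all.2 fun k => ?_
    have : Continuous fun s => ζ s - (p k + s * v k) := by fun_prop
    exact (this.tendsto 0).eventually (eventually_notMem_lattice (by simpa using h k))
  have hr' : Continuous fun s => z + r s := by fun_prop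
  have hc₁ : ContinuousAt
      (fun s => q (z + r s) * thetaProd θ (fun k => p k + s * v k) w (z + r s)) 0 :=
    (hq.diff.continuous.comp hr').continuousAt.mul (hθ.continuousAt_thetaProd v hr' h₂)
  have hc₂ : ContinuousAt (fun s => q z * thetaProd θ (fun k => p k + s * v k) w z) 0 :=
    continuousAt_const.mul
      (hθ.continuousAt_thetaProd (ζ := fun _ => z) v continuous_const h₁)
  filter_upwards [hgen (fun _ => z) continuous_const h₁, hgen _ hr' h₂,
    (hc₁.ne_iff_eventually_ne hc₂).1 (by simpa using h₃)] with s e₁ e₂ e₃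
  exact ⟨z, e₁, e₂, e₃⟩

end

section

variable {L : PeriodPair} {ι : Type*} [Fintype ι] {p : ι → ℂ} {w : ι → ℤ} {f : ℂ → ℂ}

theorem finite_image_zeros_logDeriv (hf : IsElliptic L f) (hdiv : HasDivisor L f p w)
    (hw : ∀ k, w k ≠ 0) (hp : ∀ j k, p j - p k ∈ L.lattice → j = k) [Nonempty ι] :
    ((Submodule.Quotient.mk (p := L.lattice)) ''
      {z | (∀ k, z - p k ∉ L.lattice) ∧ logDeriv f z = 0}).Finite := by
  refine (finite_support_torusOrder hf.meromorphic'.logDeriv hf.periodic_logDeriv).subset ?_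
  rintro _ ⟨z, ⟨hz, h0⟩, rfl⟩
  obtain ⟨ha, hne⟩ := hf.analyticAt_and_ne_zero (hdiv.order_eq_zero hz)
  have hha : AnalyticAt ℂ (logDeriv f) z := ha.deriv.div ha hne
  rw [Function.mem_support, torusOrder_mk hf.periodic_logDeriv, Ne, WithTop.untop₀_eq_zero, not_or]
  exact ⟨fun h => hha.meromorphicNFAt.meromorphicOrderAt_eq_zero_iff.1 h h0,
    hdiv.order_logDeriv_ne_top hf.meromorphic' hw hp z⟩

/-- Arbitrarily close to the divisor of an elliptic function with at least three zeros and poles,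
and with the same sum, there is a divisor all of whose elliptic functions have nondegenerate
Newton flows. -/
theorem exists_nondegenerate_divisor (hf : IsElliptic L f) (hdiv : HasDivisor L f p w)
    (hw : ∀ k, w k ≠ 0) (hp : ∀ j k, p j - p k ∈ L.lattice → j = k) (hcard : 2 < Fintype.card ι)
    {ε : ℝ} (hε : 0 < ε) :
    ∃ p' : ι → ℂ, (∀ k, ‖p' k - p k‖ < ε) ∧
      ∑ k, (w k : ℂ) * p' k = ∑ k, (w k : ℂ) * p k ∧
      (∀ j k, p' j - p' k ∈ L.lattice → j = k) ∧
      (∃ g, IsElliptic L g ∧ HasDivisor L g p' w) ∧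
      ∀ (g : ℂ → ℂ) (hg : IsElliptic L g), HasDivisor L g p' w →
        (HasBasicPeriods L f → HasBasicPeriods L g) ∧
        (saddles hg).ncard = Fintype.card ι ∧
        ∀ z : ℂ, Submodule.Quotient.mk z ∈ saddles hg →
          IsFoldSaddle g 1 z ∧ IsHyperbolicSaddle (newtonField g) z := by
  have : Nonempty ι := Fintype.card_pos_iff.1 (by omega)
  let k₀ : ι := Classical.arbitrary ι
  obtain ⟨ω₁, ω₂, κ, μ, θ, hθ⟩ := exists_isTheta L
  obtain ⟨hsum, q, c, hq, hfq⟩ := hθ.exists_elliptic_factor hf.meromorphic' hf.periodic hdiv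
  obtain ⟨v, hv, htrans⟩ := hθ.exists_transversal (p := p) hw hp hcard
    (fun z hz => hz.1) (finite_image_zeros_logDeriv hf hdiv hw hp)
  have hzeta : ∀ z, (∀ k, z - p k ∉ L.lattice) → zetaSum θ p w v c (z, 0) = logDeriv f z := by
    intro z hz
    rw [hq.logDeriv_eq_sum hθ hf hdiv hz]
    simp [zetaSum]
  have hsimple := hθ.eventually_simple_zeros (v := v) (c := c) hw hsum hp
    (fun z hz h => hdiv.order_logDeriv_ne_top hf.meromorphic' hw hp z
      (meromorphicOrderAt_eq_top_iff.2 (nhdsWithin_le_nhds (by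
        filter_upwards [h, eventually_generic p hz] with u hu hgen
        rw [← hzeta u hgen, hu]))))
    (fun z hz h0 => htrans z ⟨hz, by rw [← hzeta z hz, h0]⟩)
  -- For `i ≠ k₀` the difference `p i - p k₀` is not in the lattice, hence not a period of `f`; the
  -- perturbed difference then is not a period of the perturbed function.
  have hperiods : ∀ᶠ s in 𝓝 (0 : ℂ), HasBasicPeriods L f → ∀ i, i ≠ k₀ →
      ∃ z, (∀ k, z - (p k + s * v k) ∉ L.lattice) ∧
        (∀ k, z + (p i + s * v i - (p k₀ + s * v k₀)) - (p k + s * v k) ∉ L.lattice) ∧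
        q (z + (p i + s * v i - (p k₀ + s * v k₀))) * thetaProd θ (fun k => p k + s * v k) w
            (z + (p i + s * v i - (p k₀ + s * v k₀))) ≠
          q z * thetaProd θ (fun k => p k + s * v k) w z := by
    by_cases hbasic : HasBasicPeriods L f
    · have : ∀ i, i ≠ k₀ → _ := fun i hi => hq.eventually_not_periodic hθ hf.meromorphic hfq v
        (r := fun s => p i + s * v i - (p k₀ + s * v k₀)) (by fun_prop)
        (fun h => hi (hp i k₀ (hbasic _ (by simpa using h))))
      filter_upwards [eventually_all.2 fun i => eventually_imp_distrib_left.2 (this i)] with s hs _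
      exact hs
    · exact .of_forall fun _ h => absurd h hbasic
  have hclose : ∀ᶠ s in 𝓝 (0 : ℂ), ∀ k, ‖s * v k‖ < ε := by
    refine eventually_all.2 fun k => ?_
    have : Continuous fun s : ℂ => ‖s * v k‖ := by fun_prop
    exact (this.tendsto 0).eventually (gt_mem_nhds (by simpa using hε))
  -- Simplicity of the zeros is only available for `s ≠ 0`; the other conditions hold in a full
  -- neighbourhood of `0`.
  obtain ⟨s, hs₁, hs₂, hs₃, hs₄⟩ := (hsimple.and ((hperiods.and
    (hclose.and (eventually_distinct hp v))).filter_mono nhdsWithin_le_nhds)).exists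
  set p' : ι → ℂ := fun k => p k + s * v k with hp'
  have hρ : ∑ k, (w k : ℂ) * p' k = ∑ k, (w k : ℂ) * p k := by
    simp only [hp', mul_add, Finset.sum_add_distrib, add_eq_left]
    calc ∑ k, (w k : ℂ) * (s * v k) = s * ∑ k, (w k : ℂ) * v k := by
          rw [Finset.mul_sum]
          exact Finset.sum_congr rfl fun k _ => by ring
      _ = 0 := by rw [hv, mul_zero]
  have hq' : IsTwist ω₁ ω₂ κ q c (∑ k, (w k : ℂ) * p' k) := by rwa [hρ]
  refine ⟨p', fun k => by simpa [hp'] using hs₃ k, hρ, hs₄,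
    hq'.exists_isElliptic hθ hw hsum hs₄, fun g hg hgdiv => ?_⟩
  have hgsimple : ∀ z, (∀ k, z - p' k ∉ L.lattice) → logDeriv g z = 0 →
      deriv (logDeriv g) z ≠ 0 := by
    intro z hz h0
    have hl : ∀ u, (∀ k, u - p' k ∉ L.lattice) → logDeriv g u = zetaSum θ p w v c (u, s) :=
      fun u hu => hq'.logDeriv_eq_sum hθ hg hgdiv hu
    have hev : logDeriv g =ᶠ[𝓝 z] fun u => zetaSum θ p w v c (u, s) := by
      filter_upwards [eventually_generic p' hz] with u hu using hl u hu
    rw [hev.deriv_eq]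
    exact hs₁ z hz (by rw [← hl z hz, h0])
  refine ⟨fun hbasic r hr => ?_, ncard_saddles hg hgdiv hw hs₄ hgsimple,
    fun z hz => isFoldSaddle_of_simple hg hgdiv hw hs₄ hgsimple hz⟩
  have hord : meromorphicOrderAt g (p' k₀ + r) = w k₀ := by
    rw [← meromorphicOrderAt_comp_add_const_eq_meromorphicOrderAt,
      show g ∘ (fun z => z + r) = g from funext hr]
    exact hgdiv.order_eq hs₄ (by simp)
  -- A period `r` of `g` carries `p' k₀` to a point of nonzero order, which is some `p' i` modulo
  -- the lattice. If `i = k₀`, then `r` is a lattice point; otherwise `p' i - p' k₀` would be a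
  -- period, which `hperiods` excludes.
  obtain ⟨i, hi⟩ : ∃ i, p' k₀ + r - p' i ∈ L.lattice := by
    by_contra! h
    rw [hgdiv.order_eq_zero h] at hord
    exact hw k₀ (by exact_mod_cast hord.symm)
  by_cases hik : i = k₀
  · simpa [hik] using hi
  exfalso
  obtain ⟨z, h₁, h₂, h₃⟩ := hs₂ hbasic i hik
  obtain ⟨C, hC, hgC⟩ := hq'.eventuallyEq_const_mul hθ hg hgdiv
  have hper : g (z + (p' i - p' k₀)) = g z := by
    have e₁ := hg.periodic _ hi (z + (p' i - p' k₀))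
    rw [show z + (p' i - p' k₀) + (p' k₀ + r - p' i) = z + r by ring, hr z] at e₁
    exact e₁.symm
  rw [(hgC _ h₂).eq_of_nhds, (hgC _ h₁).eq_of_nhds] at hper
  exact h₃ (mul_left_cancel₀ hC hper)

end

/-! ### Translation between lists of zeros and poles and signed divisors. -/

section

variable {L : PeriodPair} {A B : ℕ} {f : ℂ → ℂ} {a : Fin A → ℂ} {n : Fin A → ℕ} {b : Fin B → ℂ}
  {m : Fin B → ℕ}

/-- The multiplicities of zeros and poles as the coefficients of a divisor. -/
def signedMult (n : Fin A → ℕ) (m : Fin B → ℕ) : Fin A ⊕ Fin B → ℤ :=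
  Sum.elim (fun i => (n i : ℤ)) fun j => -(m j : ℤ)

theorem HasZerosPoles.signedMult_ne_zero (h : HasZerosPoles L f a n b m) (k : Fin A ⊕ Fin B) :
    signedMult n m k ≠ 0 := by
  rcases k with i | j
  · have := h.n_pos i
    simp only [signedMult, Sum.elim_inl]
    omega
  · have := h.m_pos j
    simp only [signedMult, Sum.elim_inr]
    omega

theorem HasZerosPoles.order_eq (h : HasZerosPoles L f a n b m) (k : Fin A ⊕ Fin B) :
    meromorphicOrderAt f (Sum.elim a b k) = signedMult n m k := by
  rcases k with i | j
  · exact h.order_zero i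
  · exact h.order_pole j

/-- Congruent points have the same order, so a zero is never congruent to a pole because their
signed multiplicities have opposite signs. -/
theorem HasZerosPoles.distinct (h : HasZerosPoles L f a n b m)
    (hper : ∀ l ∈ L.lattice, Function.Periodic f l) (j k : Fin A ⊕ Fin B)
    (hjk : Sum.elim a b j - Sum.elim a b k ∈ L.lattice) : j = k := by
  have he := order_add_period hper hjk
  rw [h.order_eq, h.order_eq] at he
  have he' : signedMult n m j = signedMult n m k := by exact_mod_cast he
  rcases j with j | j <;> rcases k with k | k
  · exact congrArg _ (h.zeros_distinct j k hjk)
  · have := h.n_pos j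
    simp only [signedMult, Sum.elim_inl, Sum.elim_inr] at he'
    omega
  · have := h.n_pos k
    simp only [signedMult, Sum.elim_inl, Sum.elim_inr] at he'
    omega
  · exact congrArg _ (h.poles_distinct j k hjk)

theorem HasZerosPoles.hasDivisor (h : HasZerosPoles L f a n b m)
    (hper : ∀ l ∈ L.lattice, Function.Periodic f l) :
    HasDivisor L f (Sum.elim a b) (signedMult n m) := by
  classical
  intro z
  by_cases hz : ∃ k, z - Sum.elim a b k ∈ L.lattice
  · obtain ⟨k, hk⟩ := hz
    rw [order_add_period hper hk, h.order_eq, Finset.sum_eq_single k (fun j _ hj =>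
      if_neg fun hj' => hj (h.distinct hper j k (by simpa using sub_mem hk hj'))) (by simp),
      if_pos hk]
  · push Not at hz
    rw [Finset.sum_eq_zero fun k _ => if_neg (hz k)]
    refine le_antisymm (not_lt.1 fun h' => ?_) (not_lt.1 fun h' => ?_)
    · obtain ⟨i, hi⟩ := h.zero_mem z h'
      exact hz (Sum.inl i) hi
    · obtain ⟨j, hj⟩ := h.pole_mem z h'
      exact hz (Sum.inr j) hj

theorem HasDivisor.hasZerosPoles (hn : ∀ i, 0 < n i) (hm : ∀ j, 0 < m j)
    (hdiv : HasDivisor L f (Sum.elim a b) (signedMult n m))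
    (hp : ∀ j k, Sum.elim a b j - Sum.elim a b k ∈ L.lattice → j = k) :
    HasZerosPoles L f a n b m where
  n_pos := hn
  m_pos := hm
  zeros_distinct i i' h := Sum.inl_injective (hp (Sum.inl i) (Sum.inl i') h)
  poles_distinct j j' h := Sum.inr_injective (hp (Sum.inr j) (Sum.inr j') h)
  order_zero i := hdiv.order_eq hp (k := Sum.inl i) (by simp)
  order_pole j := hdiv.order_eq hp (k := Sum.inr j) (by simp)
  zero_mem z hz := by
    by_contra! hno
    by_cases hb : ∃ j, z - b j ∈ L.lattice
    · obtain ⟨j, hj⟩ := hb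
      rw [hdiv.order_eq hp (k := Sum.inr j) hj] at hz
      simp only [signedMult, Sum.elim_inr] at hz
      have := hm j
      have : (0 : ℤ) < -(m j : ℤ) := by exact_mod_cast hz
      omega
    · push Not at hb
      rw [hdiv.order_eq_zero (by rintro (i | j); exacts [hno i, hb j])] at hz
      exact lt_irrefl _ hz
  pole_mem z hz := by
    by_contra! hno
    by_cases hb : ∃ i, z - a i ∈ L.lattice
    · obtain ⟨i, hi⟩ := hb
      rw [hdiv.order_eq hp (k := Sum.inl i) hi] at hz
      simp only [signedMult, Sum.elim_inl] at hz
      have : (n i : ℤ) < 0 := by exact_mod_cast hz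
      omega
    · push Not at hb
      rw [hdiv.order_eq_zero (by rintro (i | j); exacts [hb i, hno j])] at hz
      exact lt_irrefl _ hz

theorem sum_signedMult (n : Fin A → ℕ) (m : Fin B → ℕ) (p : Fin A ⊕ Fin B → ℂ) :
    ∑ k, (signedMult n m k : ℂ) * p k =
      ∑ i, (n i : ℂ) * p (Sum.inl i) - ∑ j, (m j : ℂ) * p (Sum.inr j) := by
  simp [Fintype.sum_sum_type, signedMult, sub_eq_add_neg]

end

end EllipticNewton

theorem lemma5p7 (L : PeriodPair) (f : ℂ → ℂ) (hf : EllipticNewton.IsElliptic L f)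
    {A B : ℕ} (a : Fin A → ℂ) (n : Fin A → ℕ) (b : Fin B → ℂ) (m : Fin B → ℕ)
    (hdiv : EllipticNewton.HasZerosPoles L f a n b m)
    (hK : 2 < A + B) (ε : ℝ) (hε : 0 < ε) :
    ∃ (a' : Fin A → ℂ) (b' : Fin B → ℂ),
      (∀ i, ‖a' i - a i‖ < ε) ∧ (∀ j, ‖b' j - b j‖ < ε) ∧
      ∑ i, (n i : ℂ) * a' i - ∑ j, (m j : ℂ) * b' j
        = ∑ i, (n i : ℂ) * a i - ∑ j, (m j : ℂ) * b j ∧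
      (∃ g : ℂ → ℂ, EllipticNewton.IsElliptic L g ∧
        EllipticNewton.HasZerosPoles L g a' n b' m) ∧
      ∀ (g : ℂ → ℂ) (hg : EllipticNewton.IsElliptic L g),
        EllipticNewton.HasZerosPoles L g a' n b' m →
          (EllipticNewton.HasBasicPeriods L f → EllipticNewton.HasBasicPeriods L g) ∧
          (EllipticNewton.saddles hg).ncard = A + B ∧
          ∀ z : ℂ, Submodule.Quotient.mk z ∈ EllipticNewton.saddles hg →
            EllipticNewton.IsFoldSaddle g 1 z ∧
            EllipticNewton.IsHyperbolicSaddle (EllipticNewton.newtonField g) z := by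
  obtain ⟨p', hclose, hsum, hp', ⟨g₀, hg₀, hdiv₀⟩, hmain⟩ :=
    EllipticNewton.exists_nondegenerate_divisor hf (hdiv.hasDivisor hf.periodic)
      hdiv.signedMult_ne_zero (hdiv.distinct hf.periodic) (by simpa using hK) hε
  obtain ⟨a', b', rfl⟩ : ∃ a' b', p' = Sum.elim a' b' :=
    ⟨p' ∘ Sum.inl, p' ∘ Sum.inr, (Sum.elim_comp_inl_inr p').symm⟩
  rw [EllipticNewton.sum_signedMult, EllipticNewton.sum_signedMult] at hsum
  refine ⟨a', b', fun i => hclose (Sum.inl i), fun j => hclose (Sum.inr j), hsum,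
    ⟨g₀, hg₀, hdiv₀.hasZerosPoles hdiv.n_pos hdiv.m_pos hp'⟩, fun g hg hgdiv => ?_⟩
  simpa using hmain g hg (hgdiv.hasDivisor hg.periodic)
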